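/- Let $\beta_n,\alpha_n^L,\alpha_n^R$ ($n\ge 0$) be complex polynomials of degree at most $1$, none identically zero, and let $zB-A$ be the infinite tridiagonal matrix with diagonal entries $\beta_n(z)$, entries $-\alpha_n^R(z)$ in position $(n,n+1)$ and $-\alpha_n^L(z)$ in position $(n+1,n)$. Assume that $A$ and $B$ define bounded operators on $\ell^2$. Put $q_{-1}=0$, $q_0=1$, $q_{n+1}=\beta_nq_n-\alpha_{n-1}^L\alpha_{n-1}^Rq_{n-1}$ (with $\alpha_{-1}^L=\alpha_{-1}^R=1$), and $$q_n^L=\frac{q_n}{\prod_{k<n}\alpha_k^L},\qquad q_n^R=\frac{q_n}{\prod_{k<n}\alpha_k^R}.$$ Let $\rho(A,B)\subset\overline{\mathbb C}$ be the set of $z\in\mathbb C$ for which $zB-A$ has a bounded inverse, together with $\infty$ if $B$ has a bounded inverse, and let $m(z)=\langle (zB-A)^{-1}e_0,e_0\rangle$ for $z\in\rho(A,B)\cap\mathbb C$. Suppose that $\Gamma_{ext}\subset\overline{\mathbb C}$ is a domain whose boundary $\Gamma\subset\mathbb C$ is a rectifiable Jordan curve, oriented such that $\Gamma_{ext}$ lies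 on its right, that $\mathrm{Clos}(\Gamma_{ext})\subset\rho(A,B)$, that $\infty\in\Gamma_{ext}$ if $\infty\in\rho(A,B)$, and that $\Gamma_{ext}$ contains the root of each $\alpha_n^L$ and of each $\alpha_n^R$ (this root being $\infty$ for a constant polynomial). Let $x_0\in\Gamma_{ext}\cap\mathbb C$ be such that there is a factorization $x_0B-A=LDU$ with $D=\mathrm{diag}(d_0(x_0),d_1(x_0),\dots)$, $L$ lower bidiagonal with unit diagonal and subdiagonal entries $-v_n^L(x_0)$ in position $(n+1,n)$, and $U$ upper bidiagonal with unit diagonal and superdiagonal entries $-v_n^R(x_0)$ in position $(n,n+1)$. Define for $n\ge 0$ $$Q_n^L(x_0,x)=\frac{q_n^L(x)-v_n^L(x_0)q_{n+1}^L(x)}{x_0-x},\qquad Q_n^R(x_0,x)=\frac{q_n^R(x)-v_n^R(x_0)q_{n+1}^R(x)}{x_0-x}.$$ Then all $d_j(x_0)$ are nonzero, and for all $j,k\ge 0$ the following integral exists and $$\frac1{2\pi i}\int_\Gamma Q_j^L(x_0,x)\,Q_k^R(x_0,x)\,(x_0-x)\,m(x)\,dx=\frac{\delta_{j,k}}{d_j(x_0)}.$$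 -/

import Mathlib

open Polynomial
open scoped OnePoint

/-- The data of a continued fraction
`1/(β₀ - α₀ᴸ α₀ᴿ/(β₁ - α₁ᴸ α₁ᴿ/(β₂ - ⋯)))`:
polynomials of degree at most one, none of them identically zero. -/
structure MPFraction where
  beta : ℕ → ℂ[X]
  alphaL : ℕ → ℂ[X]
  alphaR : ℕ → ℂ[X]
  beta_degree : ∀ n, (beta n).natDegree ≤ 1
  alphaL_degree : ∀ n, (alphaL n).natDegree ≤ 1
  alphaR_degree : ∀ n, (alphaR n).natDegree ≤ 1
  beta_ne_zero : ∀ n, beta n ≠ 0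
  alphaL_ne_zero : ∀ n, alphaL n ≠ 0
  alphaR_ne_zero : ∀ n, alphaR n ≠ 0

/-- The Hilbert space `ℓ²` of square summable complex sequences. -/
abbrev L2Seq : Type := lp (fun _ : ℕ => ℂ) 2

/-- The canonical vectors `e_k` of `ℓ²`. -/
noncomputable def stdVec (k : ℕ) : L2Seq := lp.single 2 k (1 : ℂ)

/-- The bounded operator `T` on `ℓ²` acts as the infinite matrix `M`: its `k`-th column is `T e_k`. -/
def HasMatrix (T : L2Seq →L[ℂ] L2Seq) (M : Matrix ℕ ℕ ℂ) : Prop :=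
  ∀ j k, (T (stdVec k) : ℕ → ℂ) j = M j k

/-- Product of infinite matrices. It is used only for matrices all of whose rows are finitely
supported, so that every sum below is a finite sum. -/
noncomputable def infMul (M N : Matrix ℕ ℕ ℂ) : Matrix ℕ ℕ ℂ :=
  Matrix.of fun i k => ∑ᶠ j, M i j * N j k

/-- Lower bidiagonal: ones on the diagonal, and `-v_n` in position `(n+1, n)`. -/
def lowerBidiag (v : ℕ → ℂ) : Matrix ℕ ℕ ℂ :=
  Matrix.of fun i j => if i = j then 1 else if i = j + 1 then -v j else 0

/-- Upper bidiagonal: ones on the diagonal, and `-v_n` in position `(n, n+1)`. -/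
def upperBidiag (v : ℕ → ℂ) : Matrix ℕ ℕ ℂ :=
  Matrix.of fun i j => if i = j then 1 else if j = i + 1 then -v i else 0

/-- The point of the Riemann sphere at which a nonzero polynomial of degree at most one vanishes:
its root, or `∞` if the polynomial is constant. -/
noncomputable def rootPoint (p : ℂ[X]) : OnePoint ℂ :=
  if p.natDegree = 0 then ∞ else ((-p.coeff 0 / p.coeff 1 : ℂ) : OnePoint ℂ)

namespace MPFraction

variable (F : MPFraction)

/-- The tridiagonal pencil `zB - A`, with entries that are polynomials in `z`. -/
noncomputable def pencil : Matrix ℕ ℕ ℂ[X] :=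
  Matrix.of fun i j =>
    if i = j then F.beta i
    else if j = i + 1 then -F.alphaR i
    else if i = j + 1 then -F.alphaL j
    else 0

/-- The matrix `A`: minus the constant coefficients of the pencil `zB - A`. -/
noncomputable def matA : Matrix ℕ ℕ ℂ := F.pencil.map fun p => -p.coeff 0

/-- The matrix `B`: the coefficients of `z` in the pencil `zB - A`. -/
noncomputable def matB : Matrix ℕ ℕ ℂ := F.pencil.map fun p => p.coeff 1

/-- Denominators of the convergents: `q_{n+1} = β_n q_n - α_{n-1}ᴸ α_{n-1}ᴿ q_{n-1}`,
with `q_0 = 1` and `q_{-1} = 0`. -/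
noncomputable def q : ℕ → ℂ[X]
  | 0 => 1
  | 1 => F.beta 0
  | n + 2 => F.beta (n + 1) * q (n + 1) - F.alphaL n * F.alphaR n * q n

/-- The rational functions `q_nᴸ = q_n / (α_0ᴸ ⋯ α_{n-1}ᴸ)`. -/
noncomputable def qL (n : ℕ) (x : ℂ) : ℂ :=
  (F.q n).eval x / ∏ k ∈ Finset.range n, (F.alphaL k).eval x

/-- The rational functions `q_nᴿ = q_n / (α_0ᴿ ⋯ α_{n-1}ᴿ)`. -/
noncomputable def qR (n : ℕ) (x : ℂ) : ℂ :=
  (F.q n).eval x / ∏ k ∈ Finset.range n, (F.alphaR k).eval x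

/-- `L(x₀) D(x₀) U(x₀)`, where `D` is the diagonal of `d` and `L`, `U` are the unit bidiagonal
matrices given by `vL`, `vR`, is a factorization of the matrix `x₀B - A`. -/
def IsLDU (x₀ : ℂ) (d vL vR : ℕ → ℂ) : Prop :=
  x₀ • F.matB - F.matA =
    infMul (infMul (lowerBidiag vL) (Matrix.diagonal d)) (upperBidiag vR)

/-- The Christoffel transform `Q_nᴸ(x₀, x)`; `vL` comes from the factorization at `x₀`. -/
noncomputable def christoffelL (vL : ℕ → ℂ) (n : ℕ) (x₀ x : ℂ) : ℂ :=
  (F.qL n x - vL n * F.qL (n + 1) x) / (x₀ - x)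

/-- The Christoffel transform `Q_nᴿ(x₀, x)`; `vR` comes from the factorization at `x₀`. -/
noncomputable def christoffelR (vR : ℕ → ℂ) (n : ℕ) (x₀ x : ℂ) : ℂ :=
  (F.qR n x - vR n * F.qR (n + 1) x) / (x₀ - x)

end MPFraction

/-- The resolvent set `ρ(A,B)` as a subset of the Riemann sphere: a finite point `z` belongs to it
iff `zB - A` is boundedly invertible, and `∞` belongs to it iff `B` is boundedly invertible. -/
def pencilResolventSet (A B : L2Seq →L[ℂ] L2Seq) : Set (OnePoint ℂ) :=
  {w | (∃ z : ℂ, w = (z : OnePoint ℂ) ∧ IsUnit (z • B - A)) ∨ (w = ∞ ∧ IsUnit B)}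

/-- The Weyl function `m(z) = ⟨(zB - A)⁻¹ e₀, e₀⟩` (for `z` in the resolvent set). -/
noncomputable def weylM (A B : L2Seq →L[ℂ] L2Seq) (z : ℂ) : ℂ :=
  (Ring.inverse (z • B - A) (stdVec 0) : ℕ → ℂ) 0

/-- The complex one-form `f(z) dz`. -/
noncomputable def formDz (f : ℂ → ℂ) (z : ℂ) : ℂ →L[ℂ] ℂ :=
  f z • ContinuousLinearMap.id ℂ ℂ

/-- The contour integral `∫_γ f(z) dz`. -/
noncomputable def contourIntegral {p : ℂ} (γ : Path p p) (f : ℂ → ℂ) : ℂ :=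
  curveIntegral (formDz f) γ

/-- The contour integral `∫_γ f(z) dz` makes sense. -/
def ContourIntegrable {p : ℂ} (γ : Path p p) (f : ℂ → ℂ) : Prop :=
  CurveIntegrable (formDz f) γ

/-- Winding number of the closed path `γ` about a point `z` off `γ`. -/
noncomputable def windingNum {p : ℂ} (γ : Path p p) (z : ℂ) : ℂ :=
  (2 * Real.pi * Complex.I)⁻¹ * contourIntegral γ fun ζ => (ζ - z)⁻¹

/-- `γ` parametrizes a rectifiable Jordan curve. (Every rectifiable Jordan curve has such a Lipschitz
parametrization, proportional to arc length.) -/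
structure IsJordanPath {p : ℂ} (γ : Path p p) : Prop where
  lipschitz : ∃ K : NNReal, LipschitzWith K γ
  injective : Set.InjOn γ {t | t ≠ 1}

/-- `G` is a domain of the Riemann sphere whose boundary is the (rectifiable) Jordan curve
parametrized by `γ`, and `γ` is oriented so that `G` lies on its right: the winding number of `γ`
increases by one when one passes from `G` to the other side of the curve. -/
structure IsRightJordanDomain (G : Set (OnePoint ℂ)) {p : ℂ} (γ : Path p p) : Prop where
  isOpen : IsOpen G
  connected : IsConnected G
  jordan : IsJordanPath γ
  frontier_eq : frontier G = (fun z : ℂ => (z : OnePoint ℂ)) '' Set.range γ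
  right : ∀ z w : ℂ, (z : OnePoint ℂ) ∈ G → (w : OnePoint ℂ) ∉ closure G →
    windingNum γ w = windingNum γ z + 1

/-- The standing assumption on the exterior domain `G` with boundary curve `γ`: it contains the zeros
(possibly `∞`) of all `α_kᴸ`, `α_kᴿ`, its closure is contained in the resolvent set, and it contains
`∞` as soon as the resolvent set does. -/
structure IsExteriorDomain (F : MPFraction) (A B : L2Seq →L[ℂ] L2Seq)
    (G : Set (OnePoint ℂ)) {p : ℂ} (γ : Path p p) : Prop where
  domain : IsRightJordanDomain G γ
  rootL_mem : ∀ k, rootPoint (F.alphaL k) ∈ G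
  rootR_mem : ∀ k, rootPoint (F.alphaR k) ∈ G
  closure_subset : closure G ⊆ pencilResolventSet A B
  infty_mem : ∞ ∈ pencilResolventSet A B → ∞ ∈ G

/-! Write `R(x) = (xB - A)⁻¹`. Expanding the Christoffel transforms turns the integrand into a
combination of four terms `qᴿ_i qᴸ_n m / (x₀ - x)` with `i ∈ {k, k+1}` and `n ∈ {j, j+1}`. On the
curve, `qᴿ_i qᴸ_n m` is the entry `R_{i,n}` plus a rational remainder built from solutions of the
second kind (`qR_mul_qL_mul_weylM`).

The two pieces are integrated from opposite sides of the curve. The entry `R_{i,n}` is holomorphic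
on a neighbourhood of the closure of `G` and vanishes at `∞` if `∞ ∈ G`; Cauchy's formula in `G`
gives the value `R_{i,n}(x₀)` (`contourIntegral_resolventEntry`). The remainder divided by `x - x₀`
has poles only in `G`, so its integral is zero (`contourIntegral_remainder`). Both follow from
`contourIntegral_cauchy`, which needs only the jump of the winding number across the curve and no
Jordan curve theorem.

The four values combine to the entry `(k, j)` of `U R(x₀) L`. This matrix is `D⁻¹` because `x₀B - A
= LDU` (`diagonal_mul_transformed_inverse`); its diagonal entries also show `d j ≠ 0`. -/

section ContourIntegral

/-! ### Contour integrals along Lipschitz paths and a global Cauchy formula. -/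

open MeasureTheory Filter Topology Metric Set

/-- An integral depending holomorphically on a parameter, with a locally uniform bound, is
holomorphic in the parameter. -/
theorem differentiableAt_integral_of_bounded {α : Type*} [MeasurableSpace α] {μ : Measure α}
    [IsFiniteMeasure μ] {F : ℂ → α → ℂ} {z₀ : ℂ} {R M : ℝ} (hR : 0 < R)
    (hmeas : ∀ z ∈ ball z₀ R, AEStronglyMeasurable (F z) μ)
    (hb : ∀ᵐ a ∂μ, ∀ z ∈ ball z₀ R, ‖F z a‖ ≤ M)
    (hd : ∀ᵐ a ∂μ, DifferentiableOn ℂ (fun z => F z a) (ball z₀ R)) :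
    DifferentiableAt ℂ (fun z => ∫ a, F z a ∂μ) z₀ := by
  have hz₀ : z₀ ∈ ball z₀ R := mem_ball_self hR
  have hR2 : (0 : ℝ) < R / 2 := by positivity
  have hsub : ball z₀ (R / 2) ⊆ ball z₀ R := ball_subset_ball (by linarith)
  have hat : ∀ᵐ a ∂μ, ∀ z ∈ ball z₀ R, HasDerivAt (fun z => F z a) (deriv (fun z => F z a) z) z := by
    filter_upwards [hd] with a ha z hz
    exact ((ha z hz).differentiableAt (isOpen_ball.mem_nhds hz)).hasDerivAt
  -- The derivative is an a.e. limit of measurable difference quotients along a sequence `u n → 0`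
  -- that keeps `z₀ + u n` in the ball.
  have hderiv_meas : AEStronglyMeasurable (fun a => deriv (fun z => F z a) z₀) μ := by
    let u : ℕ → ℂ := fun n => ((R / 2 / (n + 1) : ℝ) : ℂ)
    have hu0 : Tendsto (fun n : ℕ => R / 2 / ((n : ℝ) + 1)) atTop (𝓝 0) :=
      tendsto_const_nhds.div_atTop
        (tendsto_atTop_add_const_right _ _ tendsto_natCast_atTop_atTop)
    have hu : Tendsto u atTop (𝓝[≠] 0) := by
      rw [tendsto_nhdsWithin_iff]
      refine ⟨?_, Eventually.of_forall fun n => ?_⟩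
      · have := (Complex.continuous_ofReal.tendsto 0).comp hu0
        simpa [u, Function.comp_def] using this
      · have : (R / 2 / ((n : ℝ) + 1)) ≠ 0 := by positivity
        exact Complex.ofReal_ne_zero.2 this
    have humem : ∀ n, z₀ + u n ∈ ball z₀ R := by
      intro n
      have h1 : 0 < R / 2 / ((n : ℝ) + 1) := by positivity
      have h2 : R / 2 / ((n : ℝ) + 1) ≤ R / 2 := div_le_self hR2.le (by linarith [n.cast_nonneg (α := ℝ)])
      rw [mem_ball, dist_eq_norm, add_sub_cancel_left, Complex.norm_real, Real.norm_of_nonneg h1.le]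
      linarith
    refine aestronglyMeasurable_of_tendsto_ae (u := atTop)
      (f := fun n a => (u n)⁻¹ • (F (z₀ + u n) a - F z₀ a)) (fun n => ?_) ?_
    · exact ((hmeas _ (humem n)).sub (hmeas _ hz₀)).const_smul (u n)⁻¹
    · filter_upwards [hat] with a ha
      exact (hasDerivAt_iff_tendsto_slope_zero.1 (ha z₀ hz₀)).comp hu
  refine (hasDerivAt_integral_of_dominated_loc_of_deriv_le (s := ball z₀ (R / 2))
    (F' := fun z a => deriv (fun z => F z a) z)
    (bound := fun _ => M / (R / 4)) (ball_mem_nhds _ hR2) ?_ ?_ hderiv_meas ?_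
    (integrable_const _) ?_).2.differentiableAt
  · exact eventually_of_mem (ball_mem_nhds _ hR) hmeas
  · exact Integrable.of_bound (hmeas _ hz₀) M (hb.mono fun a ha => ha _ hz₀)
  -- Cauchy's estimate on the circle of radius `R / 4` about `z`, which stays inside `ball z₀ R`.
  · filter_upwards [hb, hd] with a ha hda z hz
    have hball : closedBall z (R / 4) ⊆ ball z₀ R := by
      intro y hy
      rw [mem_closedBall] at hy
      rw [mem_ball] at hz ⊢
      linarith [dist_triangle y z z₀]
    refine Complex.norm_deriv_le_of_forall_mem_sphere_norm_le (by positivity) ?_ ?_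
    · exact (hda.mono hball).diffContOnCl_ball subset_rfl
    · intro y hy
      exact ha y (hball (sphere_subset_closedBall hy))
  · filter_upwards [hat] with a ha z hz
    exact ha z (hsub hz)

variable {p : ℂ} {γ : Path p p} {K : NNReal}

theorem LipschitzWith.path_extend (hγ : LipschitzWith K γ) : LipschitzWith K γ.extend := by
  have h := hγ.comp (LipschitzWith.projIcc (zero_le_one (α := ℝ)))
  rw [mul_one] at h
  exact h

theorem contourIntegral_eq_integral (f : ℂ → ℂ) :
    contourIntegral γ f = ∫ t in Ioc (0 : ℝ) 1, f (γ.extend t) * deriv γ.extend t := by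
  rw [contourIntegral, curveIntegral_eq_intervalIntegral_deriv,
    intervalIntegral.integral_of_le zero_le_one]
  simp [formDz]

theorem contourIntegrable_iff (f : ℂ → ℂ) :
    ContourIntegrable γ f ↔
      IntegrableOn (fun t => f (γ.extend t) * deriv γ.extend t) (Ioc (0 : ℝ) 1) := by
  rw [ContourIntegrable, CurveIntegrable, intervalIntegrable_iff_integrableOn_Ioc_of_le zero_le_one,
    -- The one-sided derivative in the definition is identified with `deriv γ.extend` only at
    -- interior times, so the endpoint is dropped.
    integrableOn_Ioc_iff_integrableOn_Ioo, integrableOn_Ioc_iff_integrableOn_Ioo]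
  refine integrableOn_congr_fun (fun t ht => ?_) measurableSet_Ioo
  rw [curveIntegralFun_def, derivWithin_of_mem_nhds (Icc_mem_nhds ht.1 ht.2)]
  simp [formDz]

theorem extend_mem_range (t : ℝ) : γ.extend t ∈ range γ := by
  rw [← Path.extend_range]
  exact mem_range_self t

theorem aestronglyMeasurable_contour {f : ℂ → ℂ} (hf : ContinuousOn f (range γ)) (μ : Measure ℝ) :
    AEStronglyMeasurable (fun t => f (γ.extend t) * deriv γ.extend t) μ := by
  refine AEStronglyMeasurable.mul ?_ (measurable_deriv _).aestronglyMeasurable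
  exact (hf.comp_continuous γ.continuous_extend extend_mem_range).aestronglyMeasurable

/-- The speed bound holds at every `t`, since `deriv` is zero where `γ.extend` is not
differentiable. -/
theorem norm_contour_le (hγ : LipschitzWith K γ) {f : ℂ → ℂ} {M : ℝ}
    (hf : ∀ x ∈ range γ, ‖f x‖ ≤ M) (t : ℝ) : ‖f (γ.extend t) * deriv γ.extend t‖ ≤ M * K := by
  rw [norm_mul]
  have h := hf _ (extend_mem_range t)
  exact mul_le_mul h (norm_deriv_le_of_lipschitz hγ.path_extend) (norm_nonneg _)
    ((norm_nonneg _).trans h)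

theorem isCompact_range_path (γ : Path p p) : IsCompact (range γ) := isCompact_range γ.continuous

theorem contourIntegrable_of_continuousOn (hγ : LipschitzWith K γ) {f : ℂ → ℂ}
    (hf : ContinuousOn f (range γ)) : ContourIntegrable γ f := by
  obtain ⟨M, hM⟩ := (isCompact_range_path γ).exists_bound_of_continuousOn hf
  rw [contourIntegrable_iff]
  exact Integrable.of_bound (aestronglyMeasurable_contour hf _) (M * K)
    (Eventually.of_forall fun t => norm_contour_le hγ hM t)

theorem norm_contourIntegral_le (hγ : LipschitzWith K γ) {f : ℂ → ℂ} {M : ℝ}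
    (hf : ∀ x ∈ range γ, ‖f x‖ ≤ M) : ‖contourIntegral γ f‖ ≤ M * K := by
  rw [contourIntegral_eq_integral]
  have := norm_setIntegral_le_of_norm_le_const (μ := volume) (s := Ioc (0 : ℝ) 1)
    (by simp) (fun t _ => norm_contour_le hγ hf t)
  simpa using this

theorem contourIntegral_add {f g : ℂ → ℂ} (hf : ContourIntegrable γ f)
    (hg : ContourIntegrable γ g) :
    contourIntegral γ (fun x => f x + g x) = contourIntegral γ f + contourIntegral γ g := by
  rw [contourIntegrable_iff] at hf hg
  simp only [contourIntegral_eq_integral, add_mul]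
  exact integral_add hf hg

theorem contourIntegral_const_mul (c : ℂ) (f : ℂ → ℂ) :
    contourIntegral γ (fun x => c * f x) = c * contourIntegral γ f := by
  simp only [contourIntegral_eq_integral, mul_assoc]
  exact integral_const_mul c _

theorem contourIntegral_congr {f g : ℂ → ℂ} (h : ∀ x ∈ range γ, f x = g x) :
    contourIntegral γ f = contourIntegral γ g := by
  simp only [contourIntegral_eq_integral]
  congr 1
  ext t
  rw [h _ (extend_mem_range t)]

theorem contourIntegrable_congr {f g : ℂ → ℂ} (h : ∀ x ∈ range γ, f x = g x) :
    ContourIntegrable γ f ↔ ContourIntegrable γ g := by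
  simp only [contourIntegrable_iff]
  have : (fun t => f (γ.extend t) * deriv γ.extend t) =
      fun t => g (γ.extend t) * deriv γ.extend t := by
    ext t
    rw [h _ (extend_mem_range t)]
  rw [this]

theorem contourIntegral_eq_windingNum (z : ℂ) :
    contourIntegral γ (fun x => (x - z)⁻¹) = 2 * Real.pi * Complex.I * windingNum γ z := by
  rw [windingNum, ← mul_assoc, mul_inv_cancel₀ Complex.two_pi_I_ne_zero, one_mul]

/-- Cauchy transforms vanish at infinity. -/
theorem tendsto_contourIntegral_div_sub (hγ : LipschitzWith K γ) {f : ℂ → ℂ}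
    (hf : ContinuousOn f (range γ)) :
    Tendsto (fun z => contourIntegral γ fun x => f x * (x - z)⁻¹) (cocompact ℂ) (𝓝 0) := by
  obtain ⟨M, hM⟩ := (isCompact_range_path γ).exists_bound_of_continuousOn hf
  obtain ⟨r, hr⟩ := (isCompact_range_path γ).isBounded.exists_norm_le
  have hlim : Tendsto (fun z : ℂ => M * (‖z‖ - r)⁻¹ * K) (cocompact ℂ) (𝓝 0) := by
    have h1 : Tendsto (fun z : ℂ => ‖z‖ - r) (cocompact ℂ) atTop :=
      tendsto_atTop_add_const_right _ _ (tendsto_norm_cocompact_atTop)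
    simpa using (h1.inv_tendsto_atTop.const_mul M).mul_const (K : ℝ)
  refine squeeze_zero_norm' ?_ hlim
  filter_upwards [tendsto_norm_cocompact_atTop (E := ℂ) (eventually_gt_atTop r)] with z hz
  refine norm_contourIntegral_le hγ fun x hx => ?_
  have hM0 : 0 ≤ M := (norm_nonneg _).trans (hM x hx)
  have hz' : r < ‖z‖ := hz
  rw [norm_mul, norm_inv]
  gcongr
  · exact hM x hx
  · have := norm_sub_norm_le z x
    rw [norm_sub_rev] at this
    linarith [hr x hx]

theorem tendsto_windingNum (hγ : LipschitzWith K γ) :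
    Tendsto (windingNum γ) (cocompact ℂ) (𝓝 0) := by
  have := (tendsto_contourIntegral_div_sub hγ (f := fun _ => 1) continuousOn_const).const_mul
    (2 * Real.pi * Complex.I)⁻¹
  rw [mul_zero] at this
  refine this.congr fun z => ?_
  simp only [windingNum, one_mul]

/-- The Cauchy transform of a continuous function is holomorphic off the curve. -/
theorem differentiableAt_contourIntegral_div_sub (hγ : LipschitzWith K γ) {f : ℂ → ℂ}
    (hf : ContinuousOn f (range γ)) {z : ℂ} (hz : z ∉ range γ) :
    DifferentiableAt ℂ (fun z => contourIntegral γ fun x => f x * (x - z)⁻¹) z := by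
  obtain ⟨M, hM⟩ := (isCompact_range_path γ).exists_bound_of_continuousOn hf
  obtain ⟨R, hR, hball⟩ := Metric.isOpen_iff.1 (isCompact_range_path γ).isClosed.isOpen_compl z hz
  have hR2 : (0 : ℝ) < R / 2 := by positivity
  have hsub : ball z (R / 2) ⊆ (range γ)ᶜ := (ball_subset_ball (by linarith)).trans hball
  have hne : ∀ w ∈ ball z (R / 2), ∀ x ∈ range γ, x - w ≠ 0 := by
    intro w hw x hx h
    exact hsub hw (sub_eq_zero.1 h ▸ hx)
  simp only [contourIntegral_eq_integral]
  refine differentiableAt_integral_of_bounded (R := R / 2) (M := M * (R / 2)⁻¹ * K) hR2 ?_ ?_ ?_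
  · intro w hw
    exact aestronglyMeasurable_contour (f := fun x => f x * (x - w)⁻¹)
      (hf.mul ((continuousOn_id.sub continuousOn_const).inv₀ (hne w hw))) _
  · refine Eventually.of_forall fun t w hw => ?_
    refine norm_contour_le hγ (f := fun x => f x * (x - w)⁻¹) (fun x hx => ?_) t
    have hM0 : 0 ≤ M := (norm_nonneg _).trans (hM x hx)
    rw [norm_mul, norm_inv]
    gcongr
    · exact hM x hx
    · have h1 : R ≤ dist x z := by
        by_contra! h
        exact hball h hx
      rw [mem_ball] at hw
      rw [← dist_eq_norm]
      linarith [dist_triangle x w z]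
  · refine Eventually.of_forall fun t w hw => ?_
    have := hne w hw _ (extend_mem_range t)
    fun_prop (disch := assumption)

/-- The integral of the divided difference of a holomorphic function is holomorphic. -/
theorem differentiableAt_contourIntegral_dslope (hγ : LipschitzWith K γ) {Ω : Set ℂ}
    (hΩ : IsOpen Ω) (hγΩ : range γ ⊆ Ω) {f : ℂ → ℂ} (hf : DifferentiableOn ℂ f Ω) {z : ℂ}
    (hz : z ∈ Ω) :
    DifferentiableAt ℂ (fun z => contourIntegral γ fun x => dslope f x z) z := by
  obtain ⟨R, hR, hball⟩ := Metric.isOpen_iff.1 hΩ z hz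
  have hcb : closedBall z (R / 2) ⊆ Ω := (closedBall_subset_ball (by linarith)).trans hball
  obtain ⟨M, hM⟩ := (isCompact_range_path γ).exists_bound_of_continuousOn
    (hf.continuousOn.mono hγΩ)
  obtain ⟨N, hN⟩ := (isCompact_closedBall z (R / 2)).exists_bound_of_continuousOn
    (hf.continuousOn.mono hcb)
  obtain ⟨C, hC⟩ := (isCompact_closedBall z (R / 2)).exists_bound_of_continuousOn
    ((hf.deriv hΩ).continuousOn.mono hcb)
  have hat : ∀ x ∈ Ω, DifferentiableAt ℂ f x := fun x hx => (hf x hx).differentiableAt (hΩ.mem_nhds hx)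
  have hC0 : 0 ≤ C := (norm_nonneg _).trans (hC z (mem_closedBall_self (by positivity)))
  have hN0 : 0 ≤ N := (norm_nonneg _).trans (hN z (mem_closedBall_self (by positivity)))
  have hR4 : (0 : ℝ) < R / 4 := by positivity
  have hsub : ball z (R / 4) ⊆ closedBall z (R / 2) :=
    ball_subset_closedBall.trans (closedBall_subset_closedBall (by linarith))
  simp only [contourIntegral_eq_integral]
  -- For `x` in the ball of radius `R / 2` the divided difference is bounded by `C` through the mean
  -- value inequality; for `x` outside it, `w` is at distance at least `R / 4` from `x`, which gives
  -- the second bound.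
  refine differentiableAt_integral_of_bounded (R := R / 4)
    (M := max C ((R / 4)⁻¹ * (M + N)) * K) hR4 ?_ ?_ ?_
  · intro w hw
    refine aestronglyMeasurable_contour (f := fun x => dslope f x w) ?_ _
    -- Divided differences are symmetric, so continuity in the base point `x` reduces to continuity
    -- of `dslope f w`.
    have h1 : ContinuousOn (dslope f w) Ω :=
      (continuousOn_dslope (hΩ.mem_nhds (hcb (hsub hw)))).2
        ⟨hf.continuousOn, hat w (hcb (hsub hw))⟩
    refine (h1.mono hγΩ).congr fun x _ => ?_
    by_cases h : x = w
    · rw [h]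
    · rw [dslope_of_ne _ h, dslope_of_ne _ (Ne.symm h), slope_comm]
  · refine Eventually.of_forall fun t w hw => ?_
    refine norm_contour_le hγ (f := fun x => dslope f x w) (fun x hx => ?_) t
    by_cases hxb : x ∈ closedBall z (R / 2)
    · refine le_max_of_le_left ?_
      by_cases h : w = x
      · rw [h, dslope_same]
        exact hC x hxb
      · rw [dslope_of_ne _ h, slope_def_field, norm_div, div_le_iff₀ (norm_pos_iff.2 (sub_ne_zero.2 h))]
        exact (convex_closedBall z (R / 2)).norm_image_sub_le_of_norm_deriv_le
          (fun y hy => hat y (hcb hy)) hC hxb (hsub hw)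
    · refine le_max_of_le_right ?_
      have hwb := hsub hw
      have hne : w ≠ x := fun h => hxb (h ▸ hwb)
      rw [dslope_of_ne _ hne, slope_def_field, norm_div, div_eq_inv_mul]
      rw [mem_closedBall, not_le] at hxb
      rw [mem_ball] at hw
      have hM0 : 0 ≤ M := (norm_nonneg _).trans (hM x hx)
      gcongr
      · rw [← dist_eq_norm]
        linarith [dist_triangle x w z, dist_comm x w]
      · refine (norm_sub_le _ _).trans ?_
        linarith [hM x hx, hN w hwb]
  · refine Eventually.of_forall fun t => ?_
    refine DifferentiableOn.mul_const ?_ _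
    exact ((Complex.differentiableOn_dslope (hΩ.mem_nhds (hγΩ (extend_mem_range t)))).2 hf).mono
      (hsub.trans hcb)

/-- Cauchy's integral formula for a closed Lipschitz curve `γ` in an open set `Ω`, outside of which
the winding number of `γ` is constant (but not necessarily zero, in which case the function has to
vanish at infinity). -/
theorem contourIntegral_cauchy (hγ : LipschitzWith K γ) {Ω V : Set ℂ} (hΩ : IsOpen Ω)
    (hV : IsOpen V) (hcover : ∀ z, z ∉ Ω → z ∈ V) (hγΩ : range γ ⊆ Ω) (hγV : Disjoint (range γ) V)
    {c : ℂ} (hc : ∀ z ∈ V, windingNum γ z = c) {f : ℂ → ℂ} (hf : DifferentiableOn ℂ f Ω)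
    (hinf : V ∈ cocompact ℂ ∨ Tendsto f (cocompact ℂ) (𝓝 0)) {z : ℂ} (hzΩ : z ∈ Ω)
    (hz : z ∉ range γ) :
    contourIntegral γ (fun x => f x * (x - z)⁻¹) =
      2 * Real.pi * Complex.I * (windingNum γ z - c) * f z := by
  classical
  have hfc : ContinuousOn f (range γ) := hf.continuousOn.mono hγΩ
  let h : ℂ → ℂ := fun z => contourIntegral γ fun x => f x * (x - z)⁻¹
  let g : ℂ → ℂ := fun z => contourIntegral γ fun x => dslope f x z
  -- Dixon's gluing: off the curve `g = h - 2πi (windingNum γ) f`, so the two branches agree on `Ω ∩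
  -- V`, where the winding number is `c`. Hence `E` is entire; it tends to zero at infinity, so it
  -- vanishes, and `E z = 0` is the formula.
  let E : ℂ → ℂ := fun z => if z ∈ Ω then g z + 2 * Real.pi * Complex.I * c * f z else h z
  have hg : ∀ z ∉ range γ, g z = h z - 2 * Real.pi * Complex.I * windingNum γ z * f z := by
    intro z hz
    have hne : ∀ x ∈ range γ, x - z ≠ 0 := fun x hx he => hz (sub_eq_zero.1 he ▸ hx)
    have hinv : ContinuousOn (fun x => (x - z)⁻¹) (range γ) :=
      (continuousOn_id.sub continuousOn_const).inv₀ hne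
    have h1 : g z = contourIntegral γ fun x => f x * (x - z)⁻¹ + (-f z) * (x - z)⁻¹ := by
      refine contourIntegral_congr fun x hx => ?_
      rw [dslope_of_ne _ (fun he : z = x => hz (he ▸ hx)), slope_comm, slope_def_field]
      have := hne x hx
      field_simp
      ring
    rw [h1, contourIntegral_add (f := fun x => f x * (x - z)⁻¹)
      (g := fun x => -f z * (x - z)⁻¹)
      (contourIntegrable_of_continuousOn hγ (hfc.mul hinv))
      (contourIntegrable_of_continuousOn hγ (continuousOn_const.mul hinv)),
      contourIntegral_const_mul, contourIntegral_eq_windingNum]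
    simp only [h]
    ring
  have hEV : ∀ z ∈ V, E z = h z := by
    intro z hzV
    by_cases hzΩ : z ∈ Ω
    · simp only [E, if_pos hzΩ]
      rw [hg z (hγV.notMem_of_mem_right hzV), hc z hzV]
      ring
    · simp only [E, if_neg hzΩ]
  have hdiff : Differentiable ℂ E := by
    intro z
    by_cases hzΩ : z ∈ Ω
    · have h1 : DifferentiableAt ℂ (fun z => g z + 2 * Real.pi * Complex.I * c * f z) z :=
        (differentiableAt_contourIntegral_dslope hγ hΩ hγΩ hf hzΩ).add
          (((hf z hzΩ).differentiableAt (hΩ.mem_nhds hzΩ)).const_mul _)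
      refine h1.congr_of_eventuallyEq ?_
      filter_upwards [hΩ.mem_nhds hzΩ] with w hw
      simp only [E, if_pos hw]
    · have hzV := hcover z hzΩ
      refine (differentiableAt_contourIntegral_div_sub hγ hfc
        (hγV.notMem_of_mem_right hzV)).congr_of_eventuallyEq ?_
      filter_upwards [hV.mem_nhds hzV] with w hw
      exact hEV w hw
  have hlim_h : Tendsto h (cocompact ℂ) (𝓝 0) := tendsto_contourIntegral_div_sub hγ hfc
  have hlim : Tendsto E (cocompact ℂ) (𝓝 0) := by
    -- Either `E = h` near infinity, or both branches tend to zero there because `f`, `h` and the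
    -- winding number do.
    rcases hinf with hVc | hf0
    · refine hlim_h.congr' ?_
      filter_upwards [hVc] with z hz
      exact (hEV z hz).symm
    · have h2 : Tendsto (fun z => h z - 2 * Real.pi * Complex.I * windingNum γ z * f z +
          2 * Real.pi * Complex.I * c * f z) (cocompact ℂ) (𝓝 0) := by
        simpa using (hlim_h.sub (((tendsto_windingNum hγ).const_mul _).mul hf0)).add
          (hf0.const_mul (2 * Real.pi * Complex.I * c))
      have h3 : Tendsto (fun z => if z ∈ Ω then h z - 2 * Real.pi * Complex.I * windingNum γ z * f z +
          2 * Real.pi * Complex.I * c * f z else h z) (cocompact ℂ) (𝓝 0) :=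
        (h2.mono_left inf_le_left).if (hlim_h.mono_left inf_le_left)
      refine h3.congr' ?_
      filter_upwards [(isCompact_range_path γ).compl_mem_cocompact] with z hz
      simp only [E]
      rw [hg z hz]
  have hE := hdiff.apply_eq_of_tendsto_cocompact z hlim
  simp only [E, if_pos hzΩ] at hE
  rw [hg z hz] at hE
  simp only [h] at hE
  linear_combination hE

end ContourIntegral

/-! ### Entries of the resolvent: recurrences, holomorphy, behaviour at infinity. -/

section Resolvent

open Filter Topology

theorem Polynomial.eval_of_natDegree_le_one {p : ℂ[X]} (hp : p.natDegree ≤ 1) (x : ℂ) :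
    p.eval x = p.coeff 1 * x + p.coeff 0 := by
  conv_lhs => rw [p.eq_X_add_C_of_natDegree_le_one hp]
  simp

theorem eq_rootPoint_of_eval_eq_zero {p : ℂ[X]} (hp : p.natDegree ≤ 1) (hp0 : p ≠ 0) {x : ℂ}
    (hx : p.eval x = 0) : rootPoint p = x := by
  have h1 : p.coeff 1 ≠ 0 := by
    intro h1
    rw [eval_of_natDegree_le_one hp, h1, zero_mul, zero_add] at hx
    apply hp0
    rw [p.eq_X_add_C_of_natDegree_le_one hp, h1, hx]
    simp
  have hd : p.natDegree ≠ 0 := fun h => h1 (coeff_eq_zero_of_natDegree_lt (by omega))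
  rw [eval_of_natDegree_le_one hp] at hx
  rw [rootPoint, if_neg hd]
  congr 1
  field_simp
  linear_combination -hx

theorem coeff_one_ne_zero_of_rootPoint_ne_infty {p : ℂ[X]} (hp : p.natDegree ≤ 1)
    (h : rootPoint p ≠ ∞) : p.coeff 1 ≠ 0 := by
  intro h1
  apply h
  rw [rootPoint, if_pos]
  rw [p.eq_X_add_C_of_natDegree_le_one hp, h1]
  simp

theorem stdVec_apply (k j : ℕ) : (stdVec k : ℕ → ℂ) j = if j = k then 1 else 0 := by
  rw [stdVec, lp.single_apply, Pi.single_apply]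

/-- Bounded functionals on `ℓ²` are determined by their values on the canonical vectors. -/
theorem L2Seq.functional_ext {φ ψ : L2Seq →L[ℂ] ℂ} (h : ∀ k, φ (stdVec k) = ψ (stdVec k)) :
    φ = ψ := by
  ext v
  have hv := lp.hasSum_single (p := 2) (by simp) v
  have key : ∀ χ : L2Seq →L[ℂ] ℂ, HasSum (fun k => v k * χ (stdVec k)) (χ v) := by
    intro χ
    convert! χ.hasSum hv using 2 with k
    have : lp.single 2 k (v k) = v k • stdVec k := by
      rw [stdVec, ← lp.single_smul, smul_eq_mul, mul_one]
    rw [this, map_smul, smul_eq_mul]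
  refine (key φ).unique ?_
  simpa only [h] using key ψ

/-- The matrix entry `⟨(zB - A)⁻¹ e_k, e_j⟩` of the resolvent. -/
noncomputable def resolventEntry (A B : L2Seq →L[ℂ] L2Seq) (z : ℂ) (j k : ℕ) : ℂ :=
  (Ring.inverse (z • B - A) (stdVec k) : ℕ → ℂ) j

variable {F : MPFraction} {A B : L2Seq →L[ℂ] L2Seq}

theorem MPFraction.natDegree_pencil_le (F : MPFraction) (i j : ℕ) :
    (F.pencil i j).natDegree ≤ 1 := by
  simp only [pencil, Matrix.of_apply]
  split_ifs
  · exact F.beta_degree _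
  · rw [natDegree_neg]; exact F.alphaR_degree _
  · rw [natDegree_neg]; exact F.alphaL_degree _
  · simp

theorem MPFraction.matrix_eq_eval_pencil (F : MPFraction) (z : ℂ) :
    z • F.matB - F.matA = F.pencil.map fun p => p.eval z := by
  ext i j
  simp only [matA, matB, Matrix.sub_apply, Matrix.smul_apply, Matrix.map_apply, smul_eq_mul]
  rw [eval_of_natDegree_le_one (F.natDegree_pencil_le i j)]
  ring

theorem hasMatrix_pencil (hA : HasMatrix A F.matA) (hB : HasMatrix B F.matB) (z : ℂ) :
    HasMatrix (z • B - A) (F.pencil.map fun p => p.eval z) := by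
  intro j k
  rw [← F.matrix_eq_eval_pencil]
  change z * (B (stdVec k) : ℕ → ℂ) j - (A (stdVec k) : ℕ → ℂ) j = _
  rw [hA j k, hB j k]
  rfl

section Recurrences

variable (hA : HasMatrix A F.matA) (hB : HasMatrix B F.matB) {z : ℂ} (hz : IsUnit (z • B - A))

include hA hB hz

/-- Column `0` of the pencil is finitely supported; applying the inverse to it gives `e_0`. The same
argument serves the later columns. -/
theorem resolventEntry_col_zero (j : ℕ) :
    (F.beta 0).eval z * resolventEntry A B z j 0 - (F.alphaL 0).eval z * resolventEntry A B z j 1 =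
      if j = 0 then 1 else 0 := by
  have h1 : (z • B - A) (stdVec 0) =
      (F.beta 0).eval z • stdVec 0 - (F.alphaL 0).eval z • stdVec 1 := by
    ext j
    rw [hasMatrix_pencil hA hB z j 0]
    simp only [lp.coeFn_sub, lp.coeFn_smul, Pi.sub_apply, Pi.smul_apply, stdVec_apply,
      MPFraction.pencil, Matrix.map_apply, Matrix.of_apply, smul_eq_mul]
    rcases j with _ | _ | j <;> simp
  have h2 : Ring.inverse (z • B - A) ((z • B - A) (stdVec 0)) = stdVec 0 := by
    rw [← mul_apply_eq_comp, Ring.inverse_mul_cancel _ hz]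
    rfl
  rw [h1, map_sub, map_smul, map_smul] at h2
  exact (congrArg (fun v : L2Seq => (v : ℕ → ℂ) j) h2).trans (stdVec_apply _ _)

theorem resolventEntry_col_succ (j k : ℕ) :
    (F.beta (k + 1)).eval z * resolventEntry A B z j (k + 1)
      - (F.alphaR k).eval z * resolventEntry A B z j k
      - (F.alphaL (k + 1)).eval z * resolventEntry A B z j (k + 2) =
      if j = k + 1 then 1 else 0 := by
  have h1 : (z • B - A) (stdVec (k + 1)) = (F.beta (k + 1)).eval z • stdVec (k + 1)
      - (F.alphaR k).eval z • stdVec k - (F.alphaL (k + 1)).eval z • stdVec (k + 2) := by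
    ext j
    rw [hasMatrix_pencil hA hB z j (k + 1)]
    simp only [lp.coeFn_sub, lp.coeFn_smul, Pi.sub_apply, Pi.smul_apply, stdVec_apply,
      MPFraction.pencil, Matrix.map_apply, Matrix.of_apply, smul_eq_mul]
    by_cases e1 : j = k + 1
    · subst e1; simp
    by_cases e2 : j = k
    · subst e2; simp
    by_cases e3 : j = k + 2
    · subst e3; simp
    have e4 : ¬ k = j := fun h => e2 h.symm
    simp [e1, e2, e3, e4]
  have h2 : Ring.inverse (z • B - A) ((z • B - A) (stdVec (k + 1))) = stdVec (k + 1) := by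
    rw [← mul_apply_eq_comp, Ring.inverse_mul_cancel _ hz]
    rfl
  rw [h1, map_sub, map_sub, map_smul, map_smul, map_smul] at h2
  exact (congrArg (fun v : L2Seq => (v : ℕ → ℂ) j) h2).trans (stdVec_apply _ _)

/-- The matrix prescribes only columns, so the row of `zB - A` is recovered as a bounded functional
by `L2Seq.functional_ext` before it is composed with the inverse. -/
theorem resolventEntry_row_zero (k : ℕ) :
    (F.beta 0).eval z * resolventEntry A B z 0 k - (F.alphaR 0).eval z * resolventEntry A B z 1 k =
      if k = 0 then 1 else 0 := by
  let e : ℕ → L2Seq →L[ℂ] ℂ := fun i => lp.evalCLM ℂ (fun _ : ℕ => ℂ) 2 i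
  have h1 : e 0 ∘L (z • B - A) = (F.beta 0).eval z • e 0 - (F.alphaR 0).eval z • e 1 := by
    refine L2Seq.functional_ext fun i => ?_
    change ((z • B - A) (stdVec i) : ℕ → ℂ) 0 = (F.beta 0).eval z * (stdVec i : ℕ → ℂ) 0 -
      (F.alphaR 0).eval z * (stdVec i : ℕ → ℂ) 1
    rw [hasMatrix_pencil hA hB z 0 i]
    simp only [stdVec_apply, MPFraction.pencil, Matrix.map_apply, Matrix.of_apply]
    rcases i with _ | _ | i <;> simp
  have h2 := congrArg (fun φ : L2Seq →L[ℂ] ℂ => φ (Ring.inverse (z • B - A) (stdVec k))) h1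
  have h3 : (z • B - A) (Ring.inverse (z • B - A) (stdVec k)) = stdVec k := by
    rw [← mul_apply_eq_comp, Ring.mul_inverse_cancel _ hz]
    rfl
  have h4 : ((z • B - A) (Ring.inverse (z • B - A) (stdVec k)) : ℕ → ℂ) 0 =
    (F.beta 0).eval z * resolventEntry A B z 0 k - (F.alphaR 0).eval z * resolventEntry A B z 1 k := h2
  rw [← h4, h3, stdVec_apply]
  simp only [eq_comm]

theorem resolventEntry_row_succ (j k : ℕ) :
    (F.beta (j + 1)).eval z * resolventEntry A B z (j + 1) k
      - (F.alphaL j).eval z * resolventEntry A B z j k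
      - (F.alphaR (j + 1)).eval z * resolventEntry A B z (j + 2) k =
      if k = j + 1 then 1 else 0 := by
  let e : ℕ → L2Seq →L[ℂ] ℂ := fun i => lp.evalCLM ℂ (fun _ : ℕ => ℂ) 2 i
  have h1 : e (j + 1) ∘L (z • B - A) = (F.beta (j + 1)).eval z • e (j + 1)
      - (F.alphaL j).eval z • e j - (F.alphaR (j + 1)).eval z • e (j + 2) := by
    refine L2Seq.functional_ext fun i => ?_
    change ((z • B - A) (stdVec i) : ℕ → ℂ) (j + 1) =
      (F.beta (j + 1)).eval z * (stdVec i : ℕ → ℂ) (j + 1)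
      - (F.alphaL j).eval z * (stdVec i : ℕ → ℂ) j
      - (F.alphaR (j + 1)).eval z * (stdVec i : ℕ → ℂ) (j + 2)
    rw [hasMatrix_pencil hA hB z (j + 1) i]
    simp only [stdVec_apply, MPFraction.pencil, Matrix.map_apply, Matrix.of_apply]
    by_cases e1 : i = j + 1
    · subst e1; simp
    by_cases e2 : i = j
    · subst e2; simp [show i ≠ i + 1 + 1 by omega]
    by_cases e3 : i = j + 2
    · subst e3; simp
    simp [Ne.symm e1, Ne.symm e2, Ne.symm e3, e3]
  have h2 := congrArg (fun φ : L2Seq →L[ℂ] ℂ => φ (Ring.inverse (z • B - A) (stdVec k))) h1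
  have h3 : (z • B - A) (Ring.inverse (z • B - A) (stdVec k)) = stdVec k := by
    rw [← mul_apply_eq_comp, Ring.mul_inverse_cancel _ hz]
    rfl
  have h4 : ((z • B - A) (Ring.inverse (z • B - A) (stdVec k)) : ℕ → ℂ) (j + 1) =
    (F.beta (j + 1)).eval z * resolventEntry A B z (j + 1) k
      - (F.alphaL j).eval z * resolventEntry A B z j k
      - (F.alphaR (j + 1)).eval z * resolventEntry A B z (j + 2) k := h2
  rw [← h4, h3, stdVec_apply]
  simp only [eq_comm]

end Recurrences

theorem isOpen_resolventSet (A B : L2Seq →L[ℂ] L2Seq) : IsOpen {z : ℂ | IsUnit (z • B - A)} :=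
  Units.isOpen.preimage (f := fun z : ℂ => z • B - A) (by fun_prop)

theorem differentiableOn_resolventEntry (A B : L2Seq →L[ℂ] L2Seq) (j k : ℕ) :
    DifferentiableOn ℂ (fun z => resolventEntry A B z j k) {z : ℂ | IsUnit (z • B - A)} := by
  intro z hz
  have h1 : DifferentiableAt ℂ (fun z : ℂ => z • B - A) z := by fun_prop
  have h2 : DifferentiableAt ℂ (fun z : ℂ => Ring.inverse (z • B - A)) z :=
    DifferentiableAt.comp z (g := Ring.inverse) (differentiableAt_inverse (𝕜 := ℂ) hz) h1
  have h3 : DifferentiableAt ℂ (fun z : ℂ => Ring.inverse (z • B - A) (stdVec k)) z :=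
    h2.clm_apply (differentiableAt_const _)
  exact ((lp.evalCLM ℂ (fun _ : ℕ => ℂ) 2 j).differentiableAt.comp z h3).differentiableWithinAt

/-- `(zB - A)⁻¹ = z⁻¹ (B - z⁻¹A)⁻¹`, and inversion is continuous at the invertible operator `B`. -/
theorem tendsto_resolventEntry (A : L2Seq →L[ℂ] L2Seq) {B : L2Seq →L[ℂ] L2Seq} (hB : IsUnit B)
    (j k : ℕ) : Tendsto (fun z => resolventEntry A B z j k) (cocompact ℂ) (𝓝 0) := by
  obtain ⟨u, rfl⟩ := hB
  have hinv : Tendsto (fun z : ℂ => z⁻¹) (cocompact ℂ) (𝓝 0) := by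
    rw [← Metric.cobounded_eq_cocompact]
    exact tendsto_inv₀_cobounded
  have h1 : Tendsto (fun z : ℂ => (u : L2Seq →L[ℂ] L2Seq) - z⁻¹ • A) (cocompact ℂ) (𝓝 u) := by
    simpa using tendsto_const_nhds.sub (hinv.smul_const A)
  have h2 : Tendsto (fun z : ℂ => z⁻¹ • Ring.inverse ((u : L2Seq →L[ℂ] L2Seq) - z⁻¹ • A))
      (cocompact ℂ) (𝓝 0) := by
    simpa using hinv.smul ((NormedRing.inverse_continuousAt u).tendsto.comp h1)
  have h3 : Tendsto (fun z : ℂ => Ring.inverse (z • (u : L2Seq →L[ℂ] L2Seq) - A))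
      (cocompact ℂ) (𝓝 0) := by
    refine h2.congr' ?_
    filter_upwards [h1 (Units.isOpen.mem_nhds u.isUnit),
      (isCompact_singleton (x := (0 : ℂ))).compl_mem_cocompact] with z hz hz0
    obtain ⟨w, hw⟩ : IsUnit ((u : L2Seq →L[ℂ] L2Seq) - z⁻¹ • A) := hz
    have hz0' : z ≠ 0 := hz0
    let v : (L2Seq →L[ℂ] L2Seq)ˣ :=
      ⟨z • (w : L2Seq →L[ℂ] L2Seq), z⁻¹ • ((w⁻¹ : (L2Seq →L[ℂ] L2Seq)ˣ) : L2Seq →L[ℂ] L2Seq),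
        by simp [smul_smul, hz0'], by simp [smul_smul, hz0']⟩
    have h4 : z • (u : L2Seq →L[ℂ] L2Seq) - A = v := by
      change _ = z • (w : L2Seq →L[ℂ] L2Seq)
      rw [hw, smul_sub, smul_smul, mul_inv_cancel₀ hz0', one_smul]
    rw [h4, ← hw, Ring.inverse_unit, Ring.inverse_unit]
    rfl
  have h5 := (((lp.evalCLM ℂ (fun _ : ℕ => ℂ) 2 j) ∘L
    (ContinuousLinearMap.apply ℂ L2Seq (stdVec k))).continuous.tendsto 0).comp h3
  rw [map_zero] at h5
  exact h5

end Resolvent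

/-! ### Three-term recurrences and the splitting of `qᴿ_j qᴸ_k m`. -/

section Recurrence

open Filter Topology

/-- The solution of `a_n u_{n+1} = b_n u_n - c_{n-1} u_{n-1}` with `u_0 = 1`, `u_{-1} = 0`. -/
noncomputable def firstKind (b a c : ℕ → ℂ) : ℕ → ℂ
  | 0 => 1
  | 1 => b 0 / a 0
  | n + 2 => (b (n + 1) * firstKind b a c (n + 1) - c n * firstKind b a c n) / a (n + 1)

/-- The solution of `a_n u_{n+1} = b_n u_n - c_{n-1} u_{n-1}` for `n ≥ 1`, with `u_0 = 0` and
`a_0 u_1 = 1`. -/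
noncomputable def secondKind (b a c : ℕ → ℂ) : ℕ → ℂ
  | 0 => 0
  | 1 => 1 / a 0
  | n + 2 => (b (n + 1) * secondKind b a c (n + 1) - c n * secondKind b a c n) / a (n + 1)

/-- The difference between the products of first kind solutions with `r 0 0` and `r` itself, where
`r` is an inverse of the tridiagonal matrix with diagonal `b`, subdiagonal `-a` and superdiagonal
`-c`. -/
noncomputable def secondKindPart (b a c : ℕ → ℂ) (j k : ℕ) : ℂ :=
  if j ≤ k then firstKind b c a j * secondKind b a c k
  else firstKind b a c k * secondKind b c a j

/-- Both sides have the same value at `0` and solve the same recurrence; the source term `1` in the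
initial equation is carried by `secondKind`. -/
theorem first_column_eq {b a c : ℕ → ℂ} {r : ℕ → ℂ} {n : ℕ} (ha : ∀ i < n, a i ≠ 0)
    (h0 : b 0 * r 0 - a 0 * r 1 = 1)
    (hs : ∀ k, b (k + 1) * r (k + 1) - c k * r k - a (k + 1) * r (k + 2) = 0) :
    r n = firstKind b a c n * r 0 - secondKind b a c n := by
  induction n using Nat.twoStepInduction with
  | zero => simp [firstKind, secondKind]
  | one =>
    have := ha 0 (by omega)
    simp only [firstKind, secondKind]
    field_simp
    linear_combination -h0
  | more n ih1 ih2 =>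
    have := ha (n + 1) (by omega)
    have e1 := ih1 fun i hi => ha i (by omega)
    have e2 := ih2 fun i hi => ha i (by omega)
    simp only [firstKind, secondKind]
    field_simp
    linear_combination -(hs n) + b (n + 1) * e2 - c n * e1

/-- Below the index `N` of the source the recurrence is homogeneous with `u_{-1} = 0`, so its
solutions are multiples of `firstKind`. The value at `N` itself is included, since it comes from the
equation with index `N - 1`. -/
theorem column_eq_of_le {b a c : ℕ → ℂ} {r : ℕ → ℂ} {n N : ℕ} (hn : n ≤ N)
    (ha : ∀ i < n, a i ≠ 0) (h0 : 0 < N → b 0 * r 0 - a 0 * r 1 = 0)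
    (hs : ∀ k, k + 1 < N → b (k + 1) * r (k + 1) - c k * r k - a (k + 1) * r (k + 2) = 0) :
    r n = firstKind b a c n * r 0 := by
  induction n using Nat.twoStepInduction with
  | zero => simp [firstKind]
  | one =>
    have := ha 0 (by omega)
    have := h0 (by omega)
    simp only [firstKind]
    field_simp
    linear_combination -this
  | more n ih1 ih2 =>
    have := ha (n + 1) (by omega)
    have e1 := ih1 (by omega) fun i hi => ha i (by omega)
    have e2 := ih2 (by omega) fun i hi => ha i (by omega)
    simp only [firstKind]
    field_simp
    linear_combination -(hs n (by omega)) + b (n + 1) * e2 - c n * e1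

/-- The entries of the inverse of a tridiagonal matrix in terms of solutions of the three term
recurrences. -/
theorem firstKind_mul_firstKind {b a c : ℕ → ℂ} {r : ℕ → ℕ → ℂ} (ha : ∀ i, a i ≠ 0)
    (hc : ∀ i, c i ≠ 0)
    (hcol0 : ∀ j, b 0 * r j 0 - a 0 * r j 1 = if j = 0 then 1 else 0)
    (hcol : ∀ j k, b (k + 1) * r j (k + 1) - c k * r j k - a (k + 1) * r j (k + 2) =
      if j = k + 1 then 1 else 0)
    (hrow0 : ∀ k, b 0 * r 0 k - c 0 * r 1 k = if k = 0 then 1 else 0)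
    (hrow : ∀ j k, b (j + 1) * r (j + 1) k - a j * r j k - c (j + 1) * r (j + 2) k =
      if k = j + 1 then 1 else 0) (j k : ℕ) :
    firstKind b c a j * firstKind b a c k * r 0 0 = r j k + secondKindPart b a c j k := by
  rw [secondKindPart]
  -- For `j ≤ k`, move up column `k` to row `0` without meeting the source, then along row `0` to
  -- the corner. The other case exchanges rows and columns.
  split_ifs with h
  · have h1 : r j k = firstKind b c a j * r 0 k := by
      refine column_eq_of_le (r := fun i => r i k) h (fun i _ => hc i) (fun hk => ?_)
        (fun i hi => ?_)
      · rw [hrow0, if_neg (by omega)]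
      · rw [hrow, if_neg (by omega)]
    have h2 : r 0 k = firstKind b a c k * r 0 0 - secondKind b a c k := by
      refine first_column_eq (r := fun i => r 0 i) (fun i _ => ha i) ?_ fun i => ?_
      · simpa using hcol0 0
      · simpa using hcol 0 i
    rw [h1, h2]
    ring
  · have h1 : r j k = firstKind b a c k * r j 0 := by
      refine column_eq_of_le (r := fun i => r j i) (by omega : k ≤ j) (fun i _ => ha i) (fun hk => ?_)
        (fun i hi => ?_)
      · rw [hcol0, if_neg (by omega)]
      · rw [hcol, if_neg (by omega)]
    have h2 : r j 0 = firstKind b c a j * r 0 0 - secondKind b c a j := by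
      refine first_column_eq (r := fun i => r i 0) (fun i _ => hc i) ?_ fun i => ?_
      · simpa using hrow0 0
      · simpa using hrow i 0
    rw [h1, h2]
    ring

section Functions

variable {b a c : ℂ → ℕ → ℂ}

theorem differentiableAt_firstKind {x : ℂ} {n : ℕ} (hb : ∀ i, DifferentiableAt ℂ (b · i) x)
    (ha : ∀ i, DifferentiableAt ℂ (a · i) x) (hc : ∀ i, DifferentiableAt ℂ (c · i) x)
    (h0 : ∀ i < n, a x i ≠ 0) : DifferentiableAt ℂ (fun x => firstKind (b x) (a x) (c x) n) x := by
  induction n using Nat.twoStepInduction with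
  | zero => simp [firstKind]
  | one =>
    simp only [firstKind]
    exact (hb 0).div (ha 0) (h0 0 (by omega))
  | more n ih1 ih2 =>
    simp only [firstKind]
    exact (((hb _).mul (ih2 fun i hi => h0 i (by omega))).sub
      ((hc _).mul (ih1 fun i hi => h0 i (by omega)))).div (ha _) (h0 _ (by omega))

theorem differentiableAt_secondKind {x : ℂ} {n : ℕ} (hb : ∀ i, DifferentiableAt ℂ (b · i) x)
    (ha : ∀ i, DifferentiableAt ℂ (a · i) x) (hc : ∀ i, DifferentiableAt ℂ (c · i) x)
    (h0 : ∀ i < n, a x i ≠ 0) : DifferentiableAt ℂ (fun x => secondKind (b x) (a x) (c x) n) x := by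
  induction n using Nat.twoStepInduction with
  | zero => simp [secondKind]
  | one =>
    simp only [secondKind]
    exact (differentiableAt_const _).div (ha 0) (h0 0 (by omega))
  | more n ih1 ih2 =>
    simp only [secondKind]
    exact (((hb _).mul (ih2 fun i hi => h0 i (by omega))).sub
      ((hc _).mul (ih1 fun i hi => h0 i (by omega)))).div (ha _) (h0 _ (by omega))

variable {l : Filter ℂ} (hinv : ∀ i, Tendsto (fun x => (a x i)⁻¹) l (𝓝 0))
  (hb : ∀ i j, ∃ y, Tendsto (fun x => b x i / a x j) l (𝓝 y))
  (hc : ∀ i j, ∃ y, Tendsto (fun x => c x i / a x j) l (𝓝 y))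

include hb hc

/-- Only the ratios `b / a` and `c / a` enter the recurrence. For `secondKind` the initial factor `1
/ a 0` forces the limit zero. -/
theorem tendsto_firstKind (n : ℕ) :
    ∃ y, Tendsto (fun x => firstKind (b x) (a x) (c x) n) l (𝓝 y) := by
  induction n using Nat.twoStepInduction with
  | zero => exact ⟨1, by simp [firstKind, tendsto_const_nhds]⟩
  | one => exact hb 0 0
  | more n ih1 ih2 =>
    obtain ⟨y1, h1⟩ := ih1
    obtain ⟨y2, h2⟩ := ih2
    obtain ⟨y3, h3⟩ := hb (n + 1) (n + 1)
    obtain ⟨y4, h4⟩ := hc n (n + 1)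
    refine ⟨y3 * y2 - y4 * y1, ((h3.mul h2).sub (h4.mul h1)).congr fun x => ?_⟩
    simp only [firstKind]
    ring

include hinv

theorem tendsto_secondKind (n : ℕ) :
    Tendsto (fun x => secondKind (b x) (a x) (c x) n) l (𝓝 0) := by
  induction n using Nat.twoStepInduction with
  | zero => simp [secondKind, tendsto_const_nhds]
  | one => simpa [secondKind] using hinv 0
  | more n ih1 ih2 =>
    obtain ⟨y3, h3⟩ := hb (n + 1) (n + 1)
    obtain ⟨y4, h4⟩ := hc n (n + 1)
    have h5 := (h3.mul ih2).sub (h4.mul ih1)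
    rw [mul_zero, mul_zero, sub_zero] at h5
    refine h5.congr fun x => ?_
    simp only [secondKind]
    ring

end Functions

theorem tendsto_eval_div_self {p : ℂ[X]} (hp : p.natDegree ≤ 1) :
    Tendsto (fun x => p.eval x / x) (cocompact ℂ) (𝓝 (p.coeff 1)) := by
  have hinv : Tendsto (fun z : ℂ => z⁻¹) (cocompact ℂ) (𝓝 0) := by
    rw [← Metric.cobounded_eq_cocompact]
    exact tendsto_inv₀_cobounded
  have h : Tendsto (fun z : ℂ => p.coeff 1 + p.coeff 0 * z⁻¹) (cocompact ℂ) (𝓝 (p.coeff 1)) := by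
    simpa using tendsto_const_nhds.add (hinv.const_mul (p.coeff 0))
  refine h.congr' ?_
  filter_upwards [(isCompact_singleton (x := (0 : ℂ))).compl_mem_cocompact] with x hx
  have hx0 : x ≠ 0 := hx
  rw [eval_of_natDegree_le_one hp]
  field_simp

theorem tendsto_eval_div_eval {p q : ℂ[X]} (hp : p.natDegree ≤ 1) (hq : q.natDegree ≤ 1)
    (hq1 : q.coeff 1 ≠ 0) : Tendsto (fun x => p.eval x / q.eval x) (cocompact ℂ)
      (𝓝 (p.coeff 1 / q.coeff 1)) := by
  refine ((tendsto_eval_div_self hp).div (tendsto_eval_div_self hq) hq1).congr' ?_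
  filter_upwards [(isCompact_singleton (x := (0 : ℂ))).compl_mem_cocompact] with x hx
  exact div_div_div_cancel_right₀ hx _ _

namespace MPFraction

variable (F : MPFraction)

/-- Values of the polynomials `β_n`. -/
noncomputable def betaAt (x : ℂ) (n : ℕ) : ℂ := (F.beta n).eval x

/-- Values of the polynomials `α_nᴸ`. -/
noncomputable def alphaLAt (x : ℂ) (n : ℕ) : ℂ := (F.alphaL n).eval x

/-- Values of the polynomials `α_nᴿ`. -/
noncomputable def alphaRAt (x : ℂ) (n : ℕ) : ℂ := (F.alphaR n).eval x

/-- Dividing the recurrence of `q` by the product of the `αᴸ` cancels one `αᴸ` in the last term,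
leaving `αᴿ` as the coefficient `c`. -/
theorem qL_eq_firstKind {x : ℂ} (hx : ∀ i, F.alphaLAt x i ≠ 0) (n : ℕ) :
    F.qL n x = firstKind (F.betaAt x) (F.alphaLAt x) (F.alphaRAt x) n := by
  have hprod : ∀ n, ∏ k ∈ Finset.range n, (F.alphaL k).eval x ≠ 0 := fun n =>
    Finset.prod_ne_zero_iff.2 fun i _ => hx i
  induction n using Nat.twoStepInduction with
  | zero => simp [qL, q, firstKind]
  | one => simp [qL, q, firstKind, betaAt, alphaLAt]
  | more n ih1 ih2 =>
    have h1 : (F.alphaL n).eval x ≠ 0 := hx n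
    have h2 : (F.alphaL (n + 1)).eval x ≠ 0 := hx (n + 1)
    have h3 := hprod n
    simp only [firstKind]
    rw [← ih1, ← ih2]
    simp only [qL, q, betaAt, alphaLAt, alphaRAt, Finset.prod_range_succ, eval_sub, eval_mul]
    field_simp

theorem qR_eq_firstKind {x : ℂ} (hx : ∀ i, F.alphaRAt x i ≠ 0) (n : ℕ) :
    F.qR n x = firstKind (F.betaAt x) (F.alphaRAt x) (F.alphaLAt x) n := by
  have hprod : ∀ n, ∏ k ∈ Finset.range n, (F.alphaR k).eval x ≠ 0 := fun n =>
    Finset.prod_ne_zero_iff.2 fun i _ => hx i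
  induction n using Nat.twoStepInduction with
  | zero => simp [qR, q, firstKind]
  | one => simp [qR, q, firstKind, betaAt, alphaRAt]
  | more n ih1 ih2 =>
    have h1 : (F.alphaR n).eval x ≠ 0 := hx n
    have h2 : (F.alphaR (n + 1)).eval x ≠ 0 := hx (n + 1)
    have h3 := hprod n
    simp only [firstKind]
    rw [← ih1, ← ih2]
    simp only [qR, q, betaAt, alphaLAt, alphaRAt, Finset.prod_range_succ, eval_sub, eval_mul]
    field_simp

/-- The rational function `qᴿ_j qᴸ_k m - ⟨(xB - A)⁻¹ e_k, e_j⟩`. -/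
noncomputable def remainder (j k : ℕ) (x : ℂ) : ℂ :=
  secondKindPart (F.betaAt x) (F.alphaLAt x) (F.alphaRAt x) j k

theorem qR_mul_qL_mul_weylM {A B : L2Seq →L[ℂ] L2Seq} (hA : HasMatrix A F.matA)
    (hB : HasMatrix B F.matB) {x : ℂ} (hx : IsUnit (x • B - A)) (hL : ∀ i, F.alphaLAt x i ≠ 0)
    (hR : ∀ i, F.alphaRAt x i ≠ 0) (j k : ℕ) :
    F.qR j x * F.qL k x * weylM A B x = resolventEntry A B x j k + F.remainder j k x := by
  rw [F.qR_eq_firstKind hR, F.qL_eq_firstKind hL]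
  -- `weylM A B x` is by definition the entry `resolventEntry A B x 0 0`.
  exact firstKind_mul_firstKind (r := resolventEntry A B x) (b := F.betaAt x) hL hR (resolventEntry_col_zero hA hB hx)
    (resolventEntry_col_succ hA hB hx) (resolventEntry_row_zero hA hB hx)
    (resolventEntry_row_succ hA hB hx) j k

/-- The poles lie among the zeros of finitely many `αᴸ_i`, `αᴿ_i`; this finiteness later makes the
domain of holomorphy open. -/
theorem differentiableAt_remainder {x : ℂ} {N j k : ℕ} (hj : j ≤ N) (hk : k ≤ N)
    (hL : ∀ i < N, F.alphaLAt x i ≠ 0) (hR : ∀ i < N, F.alphaRAt x i ≠ 0) :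
    DifferentiableAt ℂ (F.remainder j k) x := by
  have d1 : ∀ i, DifferentiableAt ℂ (F.betaAt · i) x := fun i => (F.beta i).differentiableAt
  have d2 : ∀ i, DifferentiableAt ℂ (F.alphaLAt · i) x := fun i => (F.alphaL i).differentiableAt
  have d3 : ∀ i, DifferentiableAt ℂ (F.alphaRAt · i) x := fun i => (F.alphaR i).differentiableAt
  change DifferentiableAt ℂ (fun x => F.remainder j k x) x
  simp only [remainder, secondKindPart]
  split_ifs with h
  · exact (differentiableAt_firstKind d1 d3 d2 fun i hi => hR i (by omega)).mul
      (differentiableAt_secondKind d1 d2 d3 fun i hi => hL i (by omega))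
  · exact (differentiableAt_firstKind d1 d2 d3 fun i hi => hL i (by omega)).mul
      (differentiableAt_secondKind d1 d3 d2 fun i hi => hR i (by omega))

/-- Each remainder is a first kind factor, with a finite limit, times a second kind factor tending
to zero. -/
theorem tendsto_remainder (hL : ∀ i, (F.alphaL i).coeff 1 ≠ 0) (hR : ∀ i, (F.alphaR i).coeff 1 ≠ 0)
    (j k : ℕ) : Tendsto (F.remainder j k) (cocompact ℂ) (𝓝 0) := by
  have t1 : ∀ i, Tendsto (fun x => (F.alphaLAt x i)⁻¹) (cocompact ℂ) (𝓝 0) := fun i => by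
    simpa [alphaLAt, coeff_one] using tendsto_eval_div_eval (p := 1) (by simp) (F.alphaL_degree i) (hL i)
  have t2 : ∀ i, Tendsto (fun x => (F.alphaRAt x i)⁻¹) (cocompact ℂ) (𝓝 0) := fun i => by
    simpa [alphaRAt, coeff_one] using tendsto_eval_div_eval (p := 1) (by simp) (F.alphaR_degree i) (hR i)
  have t3 : ∀ i j, ∃ y, Tendsto (fun x => F.betaAt x i / F.alphaLAt x j) (cocompact ℂ) (𝓝 y) :=
    fun i j => ⟨_, tendsto_eval_div_eval (F.beta_degree i) (F.alphaL_degree j) (hL j)⟩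
  have t4 : ∀ i j, ∃ y, Tendsto (fun x => F.betaAt x i / F.alphaRAt x j) (cocompact ℂ) (𝓝 y) :=
    fun i j => ⟨_, tendsto_eval_div_eval (F.beta_degree i) (F.alphaR_degree j) (hR j)⟩
  have t5 : ∀ i j, ∃ y, Tendsto (fun x => F.alphaRAt x i / F.alphaLAt x j) (cocompact ℂ) (𝓝 y) :=
    fun i j => ⟨_, tendsto_eval_div_eval (F.alphaR_degree i) (F.alphaL_degree j) (hL j)⟩
  have t6 : ∀ i j, ∃ y, Tendsto (fun x => F.alphaLAt x i / F.alphaRAt x j) (cocompact ℂ) (𝓝 y) :=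
    fun i j => ⟨_, tendsto_eval_div_eval (F.alphaL_degree i) (F.alphaR_degree j) (hR j)⟩
  change Tendsto (fun x => F.remainder j k x) (cocompact ℂ) (𝓝 0)
  simp only [remainder, secondKindPart]
  split_ifs with h
  · obtain ⟨y, hy⟩ := tendsto_firstKind t4 t6 j
    simpa using hy.mul (tendsto_secondKind t1 t3 t5 k)
  · obtain ⟨y, hy⟩ := tendsto_firstKind t3 t5 k
    simpa using hy.mul (tendsto_secondKind t2 t4 t6 j)

end MPFraction

end Recurrence

/-! ### The factorization `x₀B - A = LDU` and the diagonal matrix `U (x₀B - A)⁻¹ L`. -/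

section LDU

/-- The two factors of a bidiagonal factorization invert the resolvent up to a diagonal:
`U M⁻¹ L = D⁻¹` if `M = L D U`. -/
theorem diagonal_mul_transformed_inverse {b a c d vL vR : ℕ → ℂ} {r : ℕ → ℕ → ℂ}
    (hb0 : b 0 = d 0) (hb : ∀ n, b (n + 1) = d (n + 1) + vL n * d n * vR n)
    (ha : ∀ n, a n = vL n * d n) (hc : ∀ n, c n = d n * vR n)
    (hcol0 : ∀ j, b 0 * r j 0 - a 0 * r j 1 = if j = 0 then 1 else 0)
    (hcol : ∀ j k, b (k + 1) * r j (k + 1) - c k * r j k - a (k + 1) * r j (k + 2) =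
      if j = k + 1 then 1 else 0) (i n : ℕ) :
    d n * (r i n - vL n * r i (n + 1) - vR i * r (i + 1) n + vL n * vR i * r (i + 1) (n + 1)) =
      if i = n then 1 else 0 := by
  -- With `T = U M⁻¹ L D`, the identity `U M⁻¹ M = U` reads `T U = U`: column `n + 1` of `T` is that
  -- of `U` plus `vR n` times column `n` of `T`. By induction the two superdiagonal contributions
  -- cancel, which is `h3`.
  induction n with
  | zero =>
    have h1 := hcol0 i
    have h2 := hcol0 (i + 1)
    rw [if_neg (by omega)] at h2
    rw [← h1, ha, hb0] at *
    linear_combination (-vR i) * h2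
  | succ n ih =>
    have h1 := hcol i n
    have h2 := hcol (i + 1) n
    rw [hb, ha, hc] at h1 h2
    have h3 : (if i = n then (1 : ℂ) else 0) * vR n = vR i * if i + 1 = n + 1 then 1 else 0 := by
      by_cases h : i = n
      · subst h; simp
      · simp [h]
    rw [← h1]
    linear_combination (-vR i) * h2 + vR n * ih + h3

theorem infMul_lowerBidiag_diagonal (v d : ℕ → ℂ) (i k : ℕ) :
    infMul (lowerBidiag v) (Matrix.diagonal d) i k = lowerBidiag v i k * d k := by
  rw [infMul, Matrix.of_apply, finsum_eq_single _ k fun j hj => ?_]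
  · rw [Matrix.diagonal_apply_eq]
  · rw [Matrix.diagonal_apply_ne _ hj, mul_zero]

theorem infMul_upperBidiag_zero (M : Matrix ℕ ℕ ℂ) (v : ℕ → ℂ) (i : ℕ) :
    infMul M (upperBidiag v) i 0 = M i 0 := by
  rw [infMul, Matrix.of_apply, finsum_eq_single _ 0 fun j hj => ?_]
  · simp [upperBidiag]
  · simp [upperBidiag, hj]

theorem infMul_upperBidiag_succ (M : Matrix ℕ ℕ ℂ) (v : ℕ → ℂ) (i k : ℕ) :
    infMul M (upperBidiag v) i (k + 1) = M i (k + 1) - M i k * v k := by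
  rw [infMul, Matrix.of_apply, finsum_eq_sum_of_support_subset (s := {k, k + 1})]
  · rw [Finset.sum_pair (by omega)]
    simp [upperBidiag]
    ring
  · intro j hj
    simp only [Finset.coe_insert, Finset.coe_singleton, Set.mem_insert_iff, Set.mem_singleton_iff]
    by_contra! h
    apply hj
    have h1 : ¬ k = j := fun e => h.1 e.symm
    simp [upperBidiag, h.2, h1]

variable {F : MPFraction} {x₀ : ℂ} {d vL vR : ℕ → ℂ}

theorem MPFraction.IsLDU.entry_zero (h : F.IsLDU x₀ d vL vR) (i : ℕ) :
    (F.pencil i 0).eval x₀ = lowerBidiag vL i 0 * d 0 := by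
  have h1 := congrFun (congrFun h i) 0
  rwa [F.matrix_eq_eval_pencil, infMul_upperBidiag_zero, infMul_lowerBidiag_diagonal] at h1

theorem MPFraction.IsLDU.entry_succ (h : F.IsLDU x₀ d vL vR) (i k : ℕ) :
    (F.pencil i (k + 1)).eval x₀ =
      lowerBidiag vL i (k + 1) * d (k + 1) - lowerBidiag vL i k * d k * vR k := by
  have h1 := congrFun (congrFun h i) (k + 1)
  rwa [F.matrix_eq_eval_pencil, infMul_upperBidiag_succ, infMul_lowerBidiag_diagonal,
    infMul_lowerBidiag_diagonal] at h1

theorem MPFraction.IsLDU.beta_zero (h : F.IsLDU x₀ d vL vR) : (F.beta 0).eval x₀ = d 0 := by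
  simpa [pencil, lowerBidiag] using h.entry_zero 0

theorem MPFraction.IsLDU.beta_succ (h : F.IsLDU x₀ d vL vR) (n : ℕ) :
    (F.beta (n + 1)).eval x₀ = d (n + 1) + vL n * d n * vR n := by
  simpa [pencil, lowerBidiag] using h.entry_succ (n + 1) n

theorem MPFraction.IsLDU.alphaR (h : F.IsLDU x₀ d vL vR) (n : ℕ) :
    (F.alphaR n).eval x₀ = d n * vR n := by
  have h1 := h.entry_succ n n
  simp only [pencil, lowerBidiag, Matrix.of_apply, if_true, if_neg (show n ≠ n + 1 by omega),
    if_neg (show n ≠ n + 1 + 1 by omega), eval_neg] at h1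
  linear_combination -h1

theorem MPFraction.IsLDU.alphaL (h : F.IsLDU x₀ d vL vR) (n : ℕ) :
    (F.alphaL n).eval x₀ = vL n * d n := by
  cases n with
  | zero => simpa [pencil, lowerBidiag] using h.entry_zero 1
  | succ n => simpa [pencil, lowerBidiag] using h.entry_succ (n + 2) n

/-- For a boundedly invertible `x₀B - A = LDU`, the diagonal of `D` consists of the inverses of the
diagonal of `U (x₀B - A)⁻¹ L`, a matrix which is diagonal. -/
theorem MPFraction.IsLDU.mul_resolventEntry {A B : L2Seq →L[ℂ] L2Seq} (hA : HasMatrix A F.matA)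
    (hB : HasMatrix B F.matB) (hx : IsUnit (x₀ • B - A)) (h : F.IsLDU x₀ d vL vR) (i n : ℕ) :
    d n * (resolventEntry A B x₀ i n - vL n * resolventEntry A B x₀ i (n + 1)
      - vR i * resolventEntry A B x₀ (i + 1) n
      + vL n * vR i * resolventEntry A B x₀ (i + 1) (n + 1)) = if i = n then 1 else 0 :=
  diagonal_mul_transformed_inverse (b := fun n => (F.beta n).eval x₀)
    (a := fun n => (F.alphaL n).eval x₀) (c := fun n => (F.alphaR n).eval x₀)
    h.beta_zero h.beta_succ h.alphaL h.alphaR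
    (resolventEntry_col_zero hA hB hx) (resolventEntry_col_succ hA hB hx) i n

end LDU

/-! ### Cauchy's theorem on the two sides of the boundary curve. -/

section ExteriorDomain

open Filter Topology Set

theorem isUnit_of_coe_mem_pencilResolventSet {A B : L2Seq →L[ℂ] L2Seq} {z : ℂ}
    (h : (z : OnePoint ℂ) ∈ pencilResolventSet A B) : IsUnit (z • B - A) := by
  rcases h with ⟨w, hw, hu⟩ | ⟨h, -⟩
  · rwa [OnePoint.coe_injective hw]
  · exact absurd h (OnePoint.coe_ne_infty z)

theorem isUnit_of_infty_mem_pencilResolventSet {A B : L2Seq →L[ℂ] L2Seq}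
    (h : ∞ ∈ pencilResolventSet A B) : IsUnit B := by
  rcases h with ⟨w, hw, -⟩ | ⟨-, h⟩
  · exact absurd hw (OnePoint.infty_ne_coe w)
  · exact h

theorem preimage_coe_mem_cocompact {U : Set (OnePoint ℂ)} (hU : IsOpen U) (h : ∞ ∈ U) :
    ((↑) : ℂ → OnePoint ℂ) ⁻¹' U ∈ cocompact ℂ := by
  rw [← coclosedCompact_eq_cocompact]
  exact OnePoint.tendsto_coe_infty (hU.mem_nhds h)

variable {F : MPFraction} {A B : L2Seq →L[ℂ] L2Seq}

/-- The resolvent set is not the full Riemann sphere. -/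
theorem exists_not_isUnit_of_isUnit (hA : HasMatrix A F.matA) (hB : HasMatrix B F.matB)
    (hu : IsUnit B) : ∃ z : ℂ, ¬ IsUnit (z • B - A) := by
  by_contra! h
  -- Otherwise the first column of the resolvent is entire and vanishes at infinity, hence is zero,
  -- against the equation in row `0`.
  have hzero : ∀ z j, resolventEntry A B z j 0 = 0 := fun z j => by
    have hd : Differentiable ℂ fun z => resolventEntry A B z j 0 := fun z =>
      (differentiableOn_resolventEntry A B j 0 z (h z)).differentiableAt
        ((isOpen_resolventSet A B).mem_nhds (h z))
    exact hd.apply_eq_of_tendsto_cocompact z (tendsto_resolventEntry A hu j 0)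
  simpa [hzero] using resolventEntry_row_zero hA hB (h 0) 0

/-- A point beyond the curve is needed to draw any information from `right`. If none existed,
`closure G` would be the whole sphere by density of `ℂ`. -/
theorem exists_coe_notMem_closure (hA : HasMatrix A F.matA) (hB : HasMatrix B F.matB)
    {G : Set (OnePoint ℂ)} (hG : closure G ⊆ pencilResolventSet A B) :
    ∃ w : ℂ, (w : OnePoint ℂ) ∉ closure G := by
  by_contra! h
  have h1 : closure G = univ :=
    (isClosed_closure.closure_eq.symm).trans
      (OnePoint.denseRange_coe.mono (range_subset_iff.2 h)).closure_eq
  obtain ⟨z, hz⟩ := exists_not_isUnit_of_isUnit hA hB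
    (isUnit_of_infty_mem_pencilResolventSet (hG (h1 ▸ mem_univ ∞)))
  exact hz (isUnit_of_coe_mem_pencilResolventSet (hG (h z)))

namespace IsRightJordanDomain

variable {G : Set (OnePoint ℂ)} {p : ℂ} {γ : Path p p}

theorem coe_mem_frontier (hG : IsRightJordanDomain G γ) {x : ℂ} (hx : x ∈ range γ) :
    (x : OnePoint ℂ) ∈ frontier G := by
  rw [hG.frontier_eq]
  exact mem_image_of_mem _ hx

theorem coe_mem_closure (hG : IsRightJordanDomain G γ) {x : ℂ} (hx : x ∈ range γ) :
    (x : OnePoint ℂ) ∈ closure G :=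
  frontier_subset_closure (hG.coe_mem_frontier hx)

theorem coe_notMem (hG : IsRightJordanDomain G γ) {x : ℂ} (hx : x ∈ range γ) :
    (x : OnePoint ℂ) ∉ G := fun h =>
  (hG.isOpen.frontier_eq ▸ hG.coe_mem_frontier hx).2 h

theorem infty_notMem_closure (hG : IsRightJordanDomain G γ) (h : ∞ ∉ G) : ∞ ∉ closure G := by
  intro h1
  have h2 : ∞ ∈ frontier G := by
    rw [hG.isOpen.frontier_eq]
    exact ⟨h1, h⟩
  rw [hG.frontier_eq] at h2
  exact OnePoint.infty_notMem_image_coe h2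

end IsRightJordanDomain

namespace IsExteriorDomain

variable {G : Set (OnePoint ℂ)} {p : ℂ} {γ : Path p p}

theorem alphaLAt_ne_zero (hG : IsExteriorDomain F A B G γ) {x : ℂ} (hx : x ∈ range γ) (i : ℕ) :
    F.alphaLAt x i ≠ 0 := fun h =>
  hG.domain.coe_notMem hx (eq_rootPoint_of_eval_eq_zero (F.alphaL_degree i) (F.alphaL_ne_zero i) h ▸
    hG.rootL_mem i)

theorem alphaRAt_ne_zero (hG : IsExteriorDomain F A B G γ) {x : ℂ} (hx : x ∈ range γ) (i : ℕ) :
    F.alphaRAt x i ≠ 0 := fun h =>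
  hG.domain.coe_notMem hx (eq_rootPoint_of_eval_eq_zero (F.alphaR_degree i) (F.alphaR_ne_zero i) h ▸
    hG.rootR_mem i)

theorem isUnit (hG : IsExteriorDomain F A B G γ) {x : ℂ} (hx : (x : OnePoint ℂ) ∈ closure G) :
    IsUnit (x • B - A) :=
  isUnit_of_coe_mem_pencilResolventSet (hG.closure_subset hx)

theorem sub_ne_zero (hG : IsExteriorDomain F A B G γ) {x₀ x : ℂ} (hx₀ : (x₀ : OnePoint ℂ) ∈ G)
    (hx : x ∈ range γ) : x₀ - x ≠ 0 := fun h =>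
  hG.domain.coe_notMem hx (_root_.sub_eq_zero.1 h ▸ hx₀)

/-- Cauchy's formula in the exterior domain for the entries of the resolvent. -/
theorem contourIntegral_resolventEntry (hA : HasMatrix A F.matA) (hB : HasMatrix B F.matB)
    (hG : IsExteriorDomain F A B G γ) {x₀ : ℂ} (hx₀ : (x₀ : OnePoint ℂ) ∈ G) (j k : ℕ) :
    contourIntegral γ (fun x => resolventEntry A B x j k * (x - x₀)⁻¹) =
      -(2 * Real.pi * Complex.I) * resolventEntry A B x₀ j k := by
  obtain ⟨K, hK⟩ := hG.domain.jordan.lipschitz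
  obtain ⟨w, hw⟩ := exists_coe_notMem_closure hA hB hG.closure_subset
  -- Here `V` is the complement of `closure G`; the jump makes the factor `windingNum γ x₀ - c`
  -- equal to `-1`.
  have hc : ∀ z ∈ ((↑) : ℂ → OnePoint ℂ) ⁻¹' (closure G)ᶜ, windingNum γ z = windingNum γ x₀ + 1 :=
    fun z hz => hG.domain.right x₀ z hx₀ hz
  have h := contourIntegral_cauchy hK (isOpen_resolventSet A B)
    (isClosed_closure.isOpen_compl.preimage OnePoint.continuous_coe)
    (fun z hz hz' => hz (hG.isUnit hz')) (fun x hx => hG.isUnit (hG.domain.coe_mem_closure hx))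
    (disjoint_left.2 fun x hx hx' => hx' (hG.domain.coe_mem_closure hx)) hc
    (differentiableOn_resolventEntry A B j k) ?_ (hG.isUnit (subset_closure hx₀))
    (fun h => hG.domain.coe_notMem h hx₀)
  · rw [h]
    ring
  · by_cases hinf : ∞ ∈ G
    · exact Or.inr (tendsto_resolventEntry A
        (isUnit_of_infty_mem_pencilResolventSet (hG.closure_subset (subset_closure hinf))) j k)
    · exact Or.inl (preimage_coe_mem_cocompact isClosed_closure.isOpen_compl
        (hG.domain.infty_notMem_closure hinf))

/-- Cauchy's theorem in the complement of the exterior domain, which contains none of the poles. -/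
theorem contourIntegral_remainder (hA : HasMatrix A F.matA) (hB : HasMatrix B F.matB)
    (hG : IsExteriorDomain F A B G γ) {x₀ : ℂ} (hx₀ : (x₀ : OnePoint ℂ) ∈ G) (j k : ℕ) :
    contourIntegral γ (fun x => F.remainder j k x * (x - x₀)⁻¹) = 0 := by
  obtain ⟨K, hK⟩ := hG.domain.jordan.lipschitz
  obtain ⟨w, hw⟩ := exists_coe_notMem_closure hA hB hG.closure_subset
  have hwG : (w : OnePoint ℂ) ∉ G := fun h => hw (subset_closure h)
  have hwγ : w ∉ range γ := fun h => hw (hG.domain.coe_mem_closure h)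
  -- The sides are exchanged: now `V` is `G`, which contains all the poles.
  have hc : ∀ z ∈ ((↑) : ℂ → OnePoint ℂ) ⁻¹' G, windingNum γ z = windingNum γ w - 1 :=
    fun z hz => by rw [hG.domain.right z w hz hw]; ring
  let N := j + k
  let Ω : Set ℂ := {x | x ≠ x₀ ∧ ∀ i ∈ Finset.range N, F.alphaLAt x i ≠ 0 ∧ F.alphaRAt x i ≠ 0}
  have hΩ : IsOpen Ω := by
    have h1 : Ω = {x | x ≠ x₀} ∩ ⋂ i ∈ Finset.range N,
        ({x | F.alphaLAt x i ≠ 0} ∩ {x | F.alphaRAt x i ≠ 0}) := by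
      ext x
      simp [Ω]
    rw [h1]
    refine isOpen_ne.inter (isOpen_biInter_finset fun i _ => ?_)
    exact (isOpen_ne_fun (F.alphaL i).continuous continuous_const).inter
      (isOpen_ne_fun (F.alphaR i).continuous continuous_const)
  have hmem : ∀ x : ℂ, (x : OnePoint ℂ) ∉ G → x ∈ Ω := by
    refine fun x hx => ⟨fun h => hx (h ▸ hx₀), fun i _ => ⟨fun h => hx ?_, fun h => hx ?_⟩⟩
    · rw [← eq_rootPoint_of_eval_eq_zero (F.alphaL_degree i) (F.alphaL_ne_zero i) h]
      exact hG.rootL_mem i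
    · rw [← eq_rootPoint_of_eval_eq_zero (F.alphaR_degree i) (F.alphaR_ne_zero i) h]
      exact hG.rootR_mem i
  -- The factor `x - w` makes `f w = 0`, so Cauchy's formula at `w` yields the vanishing of the
  -- integral of `f x / (x - w)`, which is the desired integrand.
  let f : ℂ → ℂ := fun x => F.remainder j k x * ((x - w) / (x - x₀))
  have hf : DifferentiableOn ℂ f Ω := by
    intro x hx
    have h1 : x - x₀ ≠ 0 := _root_.sub_ne_zero.2 hx.1
    have h2 : DifferentiableAt ℂ (F.remainder j k) x :=
      F.differentiableAt_remainder (N := N) (Nat.le_add_right _ _) (Nat.le_add_left _ _)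
        (fun i hi => (hx.2 i (Finset.mem_range.2 hi)).1)
        (fun i hi => (hx.2 i (Finset.mem_range.2 hi)).2)
    exact (h2.mul (by fun_prop (disch := assumption))).differentiableWithinAt
  have h := contourIntegral_cauchy hK hΩ (hG.domain.isOpen.preimage OnePoint.continuous_coe)
    (fun z hz => not_not.1 fun hz' => hz (hmem z hz')) (fun x hx => hmem x (hG.domain.coe_notMem hx))
    (disjoint_left.2 fun x hx hx' => hG.domain.coe_notMem hx hx') hc hf ?_ (hmem w hwG) hwγ
  · have h1 : f w = 0 := by simp [f]
    rw [h1, mul_zero] at h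
    rw [← h]
    refine contourIntegral_congr fun x hx => ?_
    have h2 : x - w ≠ 0 := fun he => hwγ (_root_.sub_eq_zero.1 he ▸ hx)
    simp only [f]
    field_simp
  -- If `∞ ∉ G`, no `α` has its root at `∞`, so all have degree exactly one and the remainder
  -- vanishes at infinity.
  · by_cases hinf : ∞ ∈ G
    · exact Or.inl (preimage_coe_mem_cocompact hG.domain.isOpen hinf)
    · refine Or.inr ?_
      have h1 : Tendsto (fun x : ℂ => (x - w) / (x - x₀)) (cocompact ℂ) (𝓝 1) := by
        have h2 := tendsto_eval_div_eval (p := X - C w) (q := X - C x₀)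
          (natDegree_X_sub_C _).le (natDegree_X_sub_C _).le (by simp)
        simp only [eval_sub, eval_X, eval_C, coeff_sub, coeff_X_one, coeff_C_succ, sub_zero,
          div_one] at h2
        exact h2
      simpa using (F.tendsto_remainder
        (fun i => coeff_one_ne_zero_of_rootPoint_ne_infty (F.alphaL_degree i)
          fun h => hinf (h ▸ hG.rootL_mem i))
        (fun i => coeff_one_ne_zero_of_rootPoint_ne_infty (F.alphaR_degree i)
          fun h => hinf (h ▸ hG.rootR_mem i)) j k).mul h1

theorem continuousOn_resolventEntry (hG : IsExteriorDomain F A B G γ) {x₀ : ℂ}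
    (hx₀ : (x₀ : OnePoint ℂ) ∈ G) (j k : ℕ) :
    ContinuousOn (fun x => resolventEntry A B x j k * (x - x₀)⁻¹) (range γ) := by
  refine ((differentiableOn_resolventEntry A B j k).continuousOn.mono
    fun x hx => hG.isUnit (hG.domain.coe_mem_closure hx)).mul
      ((continuousOn_id.sub continuousOn_const).inv₀ fun x hx h => ?_)
  exact hG.sub_ne_zero hx₀ hx (_root_.sub_eq_zero.2 (_root_.sub_eq_zero.1 h).symm)

theorem continuousOn_remainder (hG : IsExteriorDomain F A B G γ) {x₀ : ℂ}
    (hx₀ : (x₀ : OnePoint ℂ) ∈ G) (j k : ℕ) :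
    ContinuousOn (fun x => F.remainder j k x * (x - x₀)⁻¹) (range γ) := by
  refine ContinuousOn.mul (fun x hx => ?_)
    ((continuousOn_id.sub continuousOn_const).inv₀ fun x hx h => ?_)
  · exact (F.differentiableAt_remainder (N := j + k) (Nat.le_add_right _ _) (Nat.le_add_left _ _)
      (fun i _ => hG.alphaLAt_ne_zero hx i)
      (fun i _ => hG.alphaRAt_ne_zero hx i)).continuousAt.continuousWithinAt
  · exact hG.sub_ne_zero hx₀ hx (_root_.sub_eq_zero.2 (_root_.sub_eq_zero.1 h).symm)

/-- Integrability of the products of denominators against the Weyl function, with the value of the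
integral. -/
theorem contourIntegral_qR_mul_qL (hA : HasMatrix A F.matA) (hB : HasMatrix B F.matB)
    (hG : IsExteriorDomain F A B G γ) {x₀ : ℂ} (hx₀ : (x₀ : OnePoint ℂ) ∈ G) (j k : ℕ) :
    ContourIntegrable γ (fun x => F.qR j x * F.qL k x * weylM A B x / (x₀ - x)) ∧
      contourIntegral γ (fun x => F.qR j x * F.qL k x * weylM A B x / (x₀ - x)) =
        2 * Real.pi * Complex.I * resolventEntry A B x₀ j k := by
  obtain ⟨K, hK⟩ := hG.domain.jordan.lipschitz
  have hcongr : ∀ x ∈ range γ, F.qR j x * F.qL k x * weylM A B x / (x₀ - x) =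
      -1 * (resolventEntry A B x j k * (x - x₀)⁻¹ + F.remainder j k x * (x - x₀)⁻¹) := by
    intro x hx
    rw [F.qR_mul_qL_mul_weylM hA hB (hG.isUnit (hG.domain.coe_mem_closure hx))
      (hG.alphaLAt_ne_zero hx) (hG.alphaRAt_ne_zero hx), ← neg_sub x x₀, div_neg, div_eq_mul_inv]
    ring
  have c1 := hG.continuousOn_resolventEntry hx₀ j k
  have c2 := hG.continuousOn_remainder hx₀ j k
  refine ⟨contourIntegrable_of_continuousOn hK
    ((continuousOn_const.mul (c1.add c2)).congr hcongr), ?_⟩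
  rw [contourIntegral_congr hcongr, contourIntegral_const_mul,
    contourIntegral_add (contourIntegrable_of_continuousOn hK c1)
      (contourIntegrable_of_continuousOn hK c2),
    hG.contourIntegral_resolventEntry hA hB hx₀, hG.contourIntegral_remainder hA hB hx₀]
  ring

end IsExteriorDomain

end ExteriorDomain

/-! ### Assembly of the four integrals. -/

theorem ContourIntegrable.add {p : ℂ} {γ : Path p p} {f g : ℂ → ℂ} (hf : ContourIntegrable γ f)
    (hg : ContourIntegrable γ g) : ContourIntegrable γ fun x => f x + g x := by
  rw [contourIntegrable_iff] at *
  simp only [add_mul]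
  exact MeasureTheory.Integrable.add hf hg

theorem ContourIntegrable.const_mul {p : ℂ} {γ : Path p p} {f : ℂ → ℂ} (c : ℂ)
    (hf : ContourIntegrable γ f) : ContourIntegrable γ fun x => c * f x := by
  rw [contourIntegrable_iff] at *
  simp only [mul_assoc]
  exact MeasureTheory.Integrable.const_mul hf c

theorem proposition4p1
    (F : MPFraction)
    (A B : L2Seq →L[ℂ] L2Seq) (hA : HasMatrix A F.matA) (hB : HasMatrix B F.matB)
    (G : Set (OnePoint ℂ)) {p : ℂ} (γ : Path p p) (hG : IsExteriorDomain F A B G γ)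
    (x₀ : ℂ) (hx₀ : (x₀ : OnePoint ℂ) ∈ G)
    (d vL vR : ℕ → ℂ) (hLDU : F.IsLDU x₀ d vL vR) (j k : ℕ) :
    d j ≠ 0 ∧
    ContourIntegrable γ (fun x =>
      F.christoffelL vL j x₀ x * F.christoffelR vR k x₀ x * (x₀ - x) * weylM A B x) ∧
    (2 * Real.pi * Complex.I)⁻¹ * contourIntegral γ (fun x =>
      F.christoffelL vL j x₀ x * F.christoffelR vR k x₀ x * (x₀ - x) * weylM A B x) =
      if j = k then 1 / d j else 0 := by
  have hu : IsUnit (x₀ • B - A) := hG.isUnit (subset_closure hx₀)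
  have hD := hLDU.mul_resolventEntry hA hB hu
  have hd : d j ≠ 0 := by
    intro h
    simpa [h] using hD j j
  let T : ℕ → ℕ → ℂ → ℂ := fun i n x => F.qR i x * F.qL n x * weylM A B x / (x₀ - x)
  have hT : ∀ i n, ContourIntegrable γ (T i n) := fun i n =>
    (hG.contourIntegral_qR_mul_qL hA hB hx₀ i n).1
  have hT' : ∀ i n, contourIntegral γ (T i n) =
      2 * Real.pi * Complex.I * resolventEntry A B x₀ i n := fun i n =>
    (hG.contourIntegral_qR_mul_qL hA hB hx₀ i n).2
  -- The weight `x₀ - x` cancels one of the two denominators. The right transform gives the row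
  -- index `k` and the left one the column index `j`.
  have hcongr : ∀ x ∈ Set.range γ,
      F.christoffelL vL j x₀ x * F.christoffelR vR k x₀ x * (x₀ - x) * weylM A B x =
      (T k j x + -vL j * T k (j + 1) x) +
        (-vR k * T (k + 1) j x + vL j * vR k * T (k + 1) (j + 1) x) := by
    intro x hx
    have h := hG.sub_ne_zero hx₀ hx
    simp only [MPFraction.christoffelL, MPFraction.christoffelR, T]
    field_simp
    ring
  have i1 := (hT k j).add ((hT k (j + 1)).const_mul (-vL j))
  have i2 := ((hT (k + 1) j).const_mul (-vR k)).add
    ((hT (k + 1) (j + 1)).const_mul (vL j * vR k))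
  refine ⟨hd, (contourIntegrable_congr hcongr).2 (i1.add i2), ?_⟩
  rw [contourIntegral_congr hcongr, contourIntegral_add i1 i2,
    contourIntegral_add (hT k j) ((hT k (j + 1)).const_mul _),
    contourIntegral_add ((hT (k + 1) j).const_mul _) ((hT (k + 1) (j + 1)).const_mul _)]
  simp only [contourIntegral_const_mul, hT']
  -- The remaining bracket is the entry `(k, j)` of `U (x₀B - A)⁻¹ L`.
  have h2 := hD k j
  have hpi := Complex.two_pi_I_ne_zero
  rw [inv_mul_eq_iff_eq_mul₀ hpi]
  have h3 : (if j = k then 1 / d j else 0) = (if k = j then (1 : ℂ) else 0) / d j := by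
    by_cases h : j = k
    · simp [h]
    · simp [h, Ne.symm h]
  rw [h3, ← h2, mul_div_cancel_left₀ _ hd]
  ring
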